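/- Let $n$ be a natural number and let $\mathbb{C}\{x\}$, $x=(x_1,\dots,x_n)$, be the ring of convergent power series at $0\in\mathbb{C}^n$. Let $f,g\in\mathbb{C}\{x\}$ be nonzero and without common irreducible factors, and put $\varphi=f/g$. Write $f=u\,f_1^{n_1}\cdots f_\alpha^{n_\alpha}$ and $g=v\,g_1^{m_1}\cdots g_\beta^{m_\beta}$ with $u,v$ units, $f_i$ (respectively $g_j$) irreducible and pairwise non-associated, and $n_i,m_j\ge 1$; put $f^{\mathrm{red}}=f_1\cdots f_\alpha$ and $g^{\mathrm{red}}=g_1\cdots g_\beta$, and let $$\theta_\varphi=f^{\mathrm{red}}g^{\mathrm{red}}\,\frac{d\varphi}{\varphi}=\frac{f^{\mathrm{red}}g^{\mathrm{red}}}{fg}\,(g\,df-f\,dg),$$ a germ of holomorphic $1$-form at $0\in\mathbb{C}^n$. Let $\mathrm{Sing}(\theta_\varphi)$ be the germ at $0$ of the common zero set of the coefficients of $\theta_\varphi$. For $h\in\mathbb{C}\{x\}$ irreducible and $\ell\ge 1$, say that $h$ is the equation of a (codimension-one) irreducible component of $\mathrm{Sing}(\theta_\varphi)$ of multiplicity $\ell$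 if the germ $\{h=0\}$ is an irreducible component of the analytic germ $\mathrm{Sing}(\theta_\varphi)$, $h^{\ell}$ divides $\theta_\varphi$ (that is, all its coefficients), and $h^{\ell+1}$ does not divide $\theta_\varphi$. Then, for every irreducible $h\in\mathbb{C}\{x\}$ and every integer $\ell\ge 1$, $h$ is the equation of a component of $\mathrm{Sing}(\theta_\varphi)$ of multiplicity $\ell$ if and only if there exists $c\in\mathbb{C}^*$ such that $h^{\ell+1}$ divides $f-cg$ and $h^{\ell+2}$ does not. -/

import Mathlib

open Filter Topology

noncomputable section

namespace ConvSeries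

/-- Absolute convergence of a formal power series on some polydisc around `0`. -/
def Convergent {n : ℕ} (f : MvPowerSeries (Fin n) ℂ) : Prop :=
  ∃ r : ℝ, 0 < r ∧ Summable fun m : Fin n →₀ ℕ => ‖MvPowerSeries.coeff m f‖ * r ^ m.degree

theorem Convergent.anti {n : ℕ} {f : MvPowerSeries (Fin n) ℂ} {r s : ℝ} (hs : 0 ≤ s)
    (hsr : s ≤ r)
    (h : Summable fun m : Fin n →₀ ℕ => ‖MvPowerSeries.coeff m f‖ * r ^ m.degree) :
    Summable fun m : Fin n →₀ ℕ => ‖MvPowerSeries.coeff m f‖ * s ^ m.degree :=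
  Summable.of_nonneg_of_le (fun m => by positivity) (fun m => by gcongr) h

theorem Convergent.add {n : ℕ} {f g : MvPowerSeries (Fin n) ℂ} (hf : Convergent f)
    (hg : Convergent g) : Convergent (f + g) := by
  obtain ⟨r, hr, hf⟩ := hf
  obtain ⟨s, hs, hg⟩ := hg
  have ht : 0 < min r s := lt_min hr hs
  refine ⟨min r s, ht, Summable.of_nonneg_of_le (fun m => by positivity) (fun m => ?_)
    ((Convergent.anti ht.le (min_le_left r s) hf).add
      (Convergent.anti ht.le (min_le_right r s) hg))⟩
  rw [map_add, ← add_mul]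
  exact mul_le_mul_of_nonneg_right (norm_add_le _ _) (by positivity)

theorem Convergent.mul {n : ℕ} {f g : MvPowerSeries (Fin n) ℂ} (hf : Convergent f)
    (hg : Convergent g) : Convergent (f * g) := by
  obtain ⟨r, hr, hf⟩ := hf
  obtain ⟨s, hs, hg⟩ := hg
  have ht : 0 < min r s := lt_min hr hs
  have hf' := Convergent.anti ht.le (min_le_left r s) hf
  have hg' := Convergent.anti ht.le (min_le_right r s) hg
  generalize min r s = t at ht hf' hg'
  let a : (Fin n →₀ ℕ) → ℝ := fun m => ‖MvPowerSeries.coeff m f‖ * t ^ m.degree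
  let b : (Fin n →₀ ℕ) → ℝ := fun m => ‖MvPowerSeries.coeff m g‖ * t ^ m.degree
  have ha : 0 ≤ a := fun m => by positivity
  have hb : 0 ≤ b := fun m => by positivity
  have hab : Summable fun x : (Fin n →₀ ℕ) × (Fin n →₀ ℕ) => a x.1 * b x.2 :=
    Summable.mul_of_nonneg hf' hg' ha hb
  refine ⟨t, ht, Summable.of_nonneg_of_le (fun m => by positivity) (fun m => ?_)
    (summable_sum_mul_antidiagonal_of_summable_mul hab)⟩
  rw [MvPowerSeries.coeff_mul]
  refine (mul_le_mul_of_nonneg_right (norm_sum_le _ _) (by positivity)).trans ?_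
  rw [Finset.sum_mul]
  refine Finset.sum_le_sum fun p hp => le_of_eq ?_
  rw [← Finset.HasAntidiagonal.mem_antidiagonal.1 hp, map_add, pow_add, norm_mul]
  simp only [a, b]
  ring

theorem Convergent.const {n : ℕ} (c : ℂ) :
    Convergent (algebraMap ℂ (MvPowerSeries (Fin n) ℂ) c) := by
  classical
  refine ⟨1, one_pos, summable_of_ne_finset_zero (s := {0}) fun m hm => ?_⟩
  rw [MvPowerSeries.algebraMap_apply, MvPowerSeries.coeff_C, if_neg (by simpa using hm)]
  simp

theorem Convergent.pderiv {n : ℕ} {f : MvPowerSeries (Fin n) ℂ} (hf : Convergent f)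
    (k : Fin n) : Convergent (MvPowerSeries.pderiv ℂ k f) := by
  obtain ⟨r, hr, hf⟩ := hf
  have hinj : Function.Injective fun m : Fin n →₀ ℕ => m + Finsupp.single k 1 :=
    add_left_injective _
  refine ⟨r / 2, by positivity, Summable.of_nonneg_of_le (fun m => by positivity) (fun m => ?_)
    ((hf.comp_injective hinj).mul_left r⁻¹)⟩
  have h1 : m k + 1 ≤ 2 ^ m.degree :=
    (Nat.lt_two_pow_self (n := m k)).trans_le
      (Nat.pow_le_pow_right two_pos (Finsupp.le_degree k m))
  have h2 : ((m k : ℝ) + 1) ≤ 2 ^ m.degree := by exact_mod_cast h1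
  have h3 : ‖((m k : ℂ) + 1)‖ = (m k : ℝ) + 1 := by
    have : ((m k : ℂ) + 1) = ((m k + 1 : ℕ) : ℂ) := by push_cast; ring
    rw [this, Complex.norm_natCast]; push_cast; ring
  have h4 : ((m k : ℝ) + 1) * (r / 2) ^ m.degree ≤ r ^ m.degree := by
    rw [div_pow, mul_div_assoc', div_le_iff₀ (by positivity), mul_comm (r ^ _)]
    gcongr
  simp only [Function.comp]
  rw [MvPowerSeries.coeff_pderiv, norm_mul, h3, map_add, Finsupp.degree_single, pow_succ]
  calc _ = ‖MvPowerSeries.coeff (m + Finsupp.single k 1) f‖ *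
          (((m k : ℝ) + 1) * (r / 2) ^ m.degree) := by ring
    _ ≤ ‖MvPowerSeries.coeff (m + Finsupp.single k 1) f‖ * r ^ m.degree := by gcongr
    _ = _ := by field_simp

/-- The ring `ℂ{x}`, `x = (x₁, …, xₙ)`, of convergent power series. -/
def convSeries (n : ℕ) : Subalgebra ℂ (MvPowerSeries (Fin n) ℂ) where
  carrier := {f | Convergent f}
  add_mem' := Convergent.add
  mul_mem' := Convergent.mul
  algebraMap_mem' := Convergent.const

/-- The partial derivative `∂/∂xₖ` on `ℂ{x}`. -/
def pd {n : ℕ} (k : Fin n) : Derivation ℂ (convSeries n) (convSeries n) where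
  toFun f := ⟨MvPowerSeries.pderiv ℂ k f, Convergent.pderiv f.2 k⟩
  map_add' _ _ := Subtype.ext (map_add (MvPowerSeries.pderiv ℂ k) _ _)
  map_smul' c _ := Subtype.ext ((MvPowerSeries.pderiv ℂ k).map_smul c _)
  map_one_eq_zero' := Subtype.ext (MvPowerSeries.pderiv ℂ k).map_one_eq_zero
  leibniz' _ _ := Subtype.ext ((MvPowerSeries.pderiv ℂ k).leibniz _ _)

/-- The value of a convergent power series at `z`. It is the sum of the series for `z` in a
neighbourhood of `0`; only such `z` matter below. -/
def value {n : ℕ} (f : convSeries n) (z : Fin n → ℂ) : ℂ :=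
  ∑' m : Fin n →₀ ℕ, MvPowerSeries.coeff m (f : MvPowerSeries (Fin n) ℂ) * m.prod (z · ^ ·)

/-! ### Germs of analytic sets at the origin

A germ is represented by a subset of `ℂⁿ`, and germs are compared by `=ᶠ[𝓝 0]` and `≤ᶠ[𝓝 0]`. -/

/-- The common zeros of a set of convergent power series. -/
def zeros {n : ℕ} (S : Set (convSeries n)) : Set (Fin n → ℂ) :=
  {z | ∀ a ∈ S, value a z = 0}

/-- `X` represents the germ at `0` of an analytic set. -/
def IsAnalyticGerm {n : ℕ} (X : Set (Fin n → ℂ)) : Prop :=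
  ∃ S : Set (convSeries n), S.Finite ∧ X =ᶠ[𝓝 0] zeros S

/-- `X` represents an irreducible germ of analytic set at `0`. -/
def IsIrreducibleGerm {n : ℕ} (X : Set (Fin n → ℂ)) : Prop :=
  IsAnalyticGerm X ∧ ¬ X =ᶠ[𝓝 0] (∅ : Set (Fin n → ℂ)) ∧
    ∀ Y Z : Set (Fin n → ℂ), IsAnalyticGerm Y → IsAnalyticGerm Z →
      X =ᶠ[𝓝 0] (Y ∪ Z : Set (Fin n → ℂ)) → X =ᶠ[𝓝 0] Y ∨ X =ᶠ[𝓝 0] Z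

/-- The germ `V` is an irreducible component of the germ `X`: a maximal irreducible germ of
analytic set contained in `X`. -/
def IsComponent {n : ℕ} (V X : Set (Fin n → ℂ)) : Prop :=
  IsIrreducibleGerm V ∧ V ≤ᶠ[𝓝 0] X ∧
    ∀ W : Set (Fin n → ℂ), IsIrreducibleGerm W → V ≤ᶠ[𝓝 0] W → W ≤ᶠ[𝓝 0] X → W =ᶠ[𝓝 0] V

/-! ### Holomorphic `1`-forms -/

/-- Germs at `0` of holomorphic `1`-forms `∑ₖ aₖ dxₖ`, given by their coefficients. -/
abbrev OneForm (n : ℕ) : Type := Fin n → convSeries n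

/-- The differential `df = ∑ₖ (∂f/∂xₖ) dxₖ`. -/
def diff {n : ℕ} (f : convSeries n) : OneForm n := fun k => pd k f

/-- The singular set of a `1`-form: the common zeros of its coefficients. -/
def sing {n : ℕ} (ω : OneForm n) : Set (Fin n → ℂ) := zeros (Set.range ω)

/-- `a` divides the `1`-form `ω`. -/
def DividesForm {n : ℕ} (a : convSeries n) (ω : OneForm n) : Prop :=
  ∃ η : OneForm n, ω = a • η

/-- `h` is an irreducible equation of a codimension one component of `Sing(ω)`, and this component
has multiplicity `ℓ`. -/
def IsSingComponent {n : ℕ} (ω : OneForm n) (h : convSeries n) (ℓ : ℕ) : Prop :=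
  Irreducible h ∧ IsComponent (zeros {h}) (sing ω) ∧
    DividesForm (h ^ ℓ) ω ∧ ¬ DividesForm (h ^ (ℓ + 1)) ω

/-- A decomposition `f = u f₁^{n₁} ⋯ f_α^{n_α}` in irreducible factors, with `u` a unit, the `fᵢ`
pairwise non-associated and the `nᵢ` positive. -/
structure Decomposition {n : ℕ} (f : convSeries n) where
  len : ℕ
  unit : (convSeries n)ˣ
  factor : Fin len → convSeries n
  exponent : Fin len → ℕ
  irreducible : ∀ i, Irreducible (factor i)
  not_associated : ∀ i j, i ≠ j → ¬ Associated (factor i) (factor j)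
  exponent_pos : ∀ i, 0 < exponent i
  eq_prod : f = unit * ∏ i, factor i ^ exponent i

/-- The reduced equation `f₁ ⋯ f_α` of `f = 0`. -/
def Decomposition.red {n : ℕ} {f : convSeries n} (D : Decomposition f) : convSeries n :=
  ∏ i, D.factor i

/-- The holomorphic `1`-form `f^red (df / f)`, which is
`f^red u⁻¹ du + ∑ᵢ nᵢ f₁ ⋯ (omit fᵢ) ⋯ f_α dfᵢ`. -/
def Decomposition.redLogDiff {n : ℕ} {f : convSeries n} (D : Decomposition f) : OneForm n :=
  (D.red * (D.unit⁻¹ : (convSeries n)ˣ)) • diff (D.unit : convSeries n) +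
    ∑ i, ((D.exponent i : convSeries n) * ∏ j ∈ Finset.univ.erase i, D.factor j) •
      diff (D.factor i)

/-- The holomorphic `1`-form `θ_φ = f^red g^red (dφ / φ)` of `φ = f / g`, where
`dφ / φ = df / f - dg / g`. -/
def theta {n : ℕ} {f g : convSeries n} (Df : Decomposition f) (Dg : Decomposition g) : OneForm n :=
  Dg.red • Df.redLogDiff - Df.red • Dg.redLogDiff

theorem pd_prod_pow {n : ℕ} (k : Fin n) {ι : Type} [DecidableEq ι] (p : ι → convSeries n)
    (e : ι → ℕ) (he : ∀ i, 0 < e i) (s : Finset ι) :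
    (∏ i ∈ s, p i) * pd k (∏ i ∈ s, p i ^ e i) =
      (∏ i ∈ s, p i ^ e i) * ∑ i ∈ s, (e i : convSeries n) * (∏ j ∈ s.erase i, p j) * pd k (p i) := by
  induction s using Finset.induction_on with
  | empty => simp
  | insert a s ha ih =>
    have h1 : ∑ i ∈ s, (e i : convSeries n) * (∏ j ∈ (insert a s).erase i, p j) * pd k (p i) =
        p a * ∑ i ∈ s, (e i : convSeries n) * (∏ j ∈ s.erase i, p j) * pd k (p i) := by
      rw [Finset.mul_sum]
      refine Finset.sum_congr rfl fun i hi => ?_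
      have hia : a ≠ i := fun h => ha (h ▸ hi)
      rw [Finset.erase_insert_of_ne hia, Finset.prod_insert (by simp [ha])]
      ring
    obtain ⟨d, hd⟩ : ∃ d, e a = d + 1 := ⟨e a - 1, by have := he a; omega⟩
    rw [Finset.prod_insert ha, Finset.prod_insert ha, Finset.sum_insert ha, h1,
      Finset.erase_insert ha, Derivation.leibniz, Derivation.leibniz_pow, hd]
    simp only [smul_eq_mul, nsmul_eq_mul, Nat.add_sub_cancel]
    linear_combination (p a ^ (d + 2)) * ih

/-- `f · redLogDiff = f^red · df`. -/
theorem Decomposition.mul_redLogDiff {n : ℕ} {f : convSeries n} (D : Decomposition f) :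
    f • D.redLogDiff = D.red • diff f := by
  funext k
  have h := pd_prod_pow k D.factor D.exponent D.exponent_pos Finset.univ
  have hu : (D.unit : convSeries n) * (D.unit⁻¹ : (convSeries n)ˣ) = 1 := D.unit.mul_inv
  have hf := D.eq_prod
  have hd : pd k f = (D.unit : convSeries n) * pd k (∏ i, D.factor i ^ D.exponent i) +
      (∏ i, D.factor i ^ D.exponent i) * pd k (D.unit : convSeries n) := by
    conv_lhs => rw [hf]
    rw [Derivation.leibniz]; rfl
  simp only [redLogDiff, red, diff, Pi.smul_apply, Pi.add_apply, Finset.sum_apply, smul_eq_mul,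
    hd] at h ⊢
  generalize (∑ i, (D.exponent i : convSeries n) *
    (∏ j ∈ Finset.univ.erase i, D.factor j) * pd k (D.factor i)) = T at *
  generalize pd k (∏ i, D.factor i ^ D.exponent i) = Q at *
  generalize (∏ i, D.factor i ^ D.exponent i) = P at *
  generalize (∏ i, D.factor i) = F at *
  linear_combination (F * (D.unit⁻¹ : (convSeries n)ˣ) * pd k (D.unit : convSeries n) + T) * hf -
    (D.unit : convSeries n) * h + P * F * pd k (D.unit : convSeries n) * hu

/-- `θ_φ = (f^red g^red / (f g)) (g df - f dg)`, so `theta` is indeed `f^red g^red (dφ / φ)`. -/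
theorem mul_theta {n : ℕ} {f g : convSeries n} (Df : Decomposition f) (Dg : Decomposition g) :
    (f * g) • theta Df Dg = (Df.red * Dg.red) • (g • diff f - f • diff g) := by
  have h1 := Df.mul_redLogDiff
  have h2 := Dg.mul_redLogDiff
  funext k
  have h1k := congrFun h1 k
  have h2k := congrFun h2 k
  simp only [theta, Pi.smul_apply, Pi.sub_apply, smul_eq_mul] at h1k h2k ⊢
  linear_combination g * Dg.red * h1k - f * Df.red * h2k

end ConvSeries

end

/-! Suppose that θ_φ vanishes along {h = 0}, with h irreducible. Then h divides neither f nor g: if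
h were associated to a factor fᵢ of f, only the term nᵢ g^red ∏_{j≠i} fⱼ dfᵢ of θ_φ would survive
modulo h, and it is nonzero there (`not_dvd_of_dvd_theta`). Hence θ_φ and g df − f dg have the same
order along h (`pow_dvd_theta_iff`). The form g df − f dg does not change when f is replaced by f −
c g. If f − c g = h^(j+1) e with h ∤ e, it equals h^j ((j+1) g e dh + h (g de − e dg)), and since h
does not divide dh, its order along h is exactly j (`pow_dvd_wronskian`). This gives the
multiplicities in both directions.

The forward direction also needs the constant c: if h divides g df − f dg, then φ is constant on {h
= 0} (`exists_dvd_sub_smul`). The argument is algebraic. After a linear change of coordinates, h is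
up to a unit a Weierstrass polynomial in x₀ over A = ℂ{x₁, …, xₙ}, so φ modulo h is algebraic over
A. Differentiating the coefficients of a relation gives another relation, so in one of minimal
degree all coefficients are constant multiples of the leading one. Thus φ modulo h is algebraic over
ℂ, and so lies in ℂ.

The converse also needs {h = 0} to be a component of the singular germ. This comes from the
Nullstellensatz for irreducible hypersurfaces (`dvd_of_vanishing`) and from unique factorization,
both consequences of Weierstrass division. The division is the fixed point of a contraction for a
weighted ℓ¹ norm. These norms take values in ℝ≥0∞, so that sums can be exchanged before any
convergence is known. -/

noncomputable section

namespace ConvSeries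

open MvPowerSeries ENNReal

/-! ### Weighted `ℓ¹` norms -/

/-- The weight `∏ᵢ wᵢ ^ mᵢ` of the monomial `x ^ m`. -/
def wt {n : ℕ} (w : Fin n → ℝ≥0∞) (m : Fin n →₀ ℕ) : ℝ≥0∞ := ∏ i, w i ^ m i

/-- The weighted `ℓ¹` norm of a power series. -/
def wnorm {n : ℕ} (w : Fin n → ℝ≥0∞) (f : MvPowerSeries (Fin n) ℂ) : ℝ≥0∞ :=
  ∑' m : Fin n →₀ ℕ, ‖coeff m f‖ₑ * wt w m

section wnorm

variable {n : ℕ} {w v : Fin n → ℝ≥0∞} {f g : MvPowerSeries (Fin n) ℂ}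

@[simp] theorem wt_zero (w : Fin n → ℝ≥0∞) : wt w 0 = 1 := by simp [wt]

theorem wt_add (w : Fin n → ℝ≥0∞) (a b : Fin n →₀ ℕ) : wt w (a + b) = wt w a * wt w b := by
  simp [wt, pow_add, Finset.prod_mul_distrib]

theorem wt_single (w : Fin n → ℝ≥0∞) (i : Fin n) (k : ℕ) :
    wt w (Finsupp.single i k) = w i ^ k := by
  rw [wt, Finset.prod_eq_single i] <;> simp +contextual [eq_comm]

theorem wt_mono (h : ∀ i, w i ≤ v i) (m : Fin n →₀ ℕ) : wt w m ≤ wt v m :=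
  Finset.prod_le_prod' fun i _ => pow_le_pow_left' (h i) _

theorem wt_ne_zero (h : ∀ i, w i ≠ 0) (m : Fin n →₀ ℕ) : wt w m ≠ 0 :=
  Finset.prod_ne_zero_iff.2 fun i _ => pow_ne_zero _ (h i)

theorem wt_ne_top (h : ∀ i, w i ≠ ⊤) (m : Fin n →₀ ℕ) : wt w m ≠ ⊤ :=
  ENNReal.prod_ne_top fun i _ => ENNReal.pow_ne_top (h i)

theorem wnorm_mono (h : ∀ i, w i ≤ v i) (f : MvPowerSeries (Fin n) ℂ) : wnorm w f ≤ wnorm v f :=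
  ENNReal.tsum_le_tsum fun m => by gcongr; exact wt_mono h m

theorem coeff_mul_wt_le_wnorm (w : Fin n → ℝ≥0∞) (f : MvPowerSeries (Fin n) ℂ) (m) :
    ‖coeff m f‖ₑ * wt w m ≤ wnorm w f :=
  ENNReal.le_tsum m

theorem wnorm_add_le (w : Fin n → ℝ≥0∞) (f g : MvPowerSeries (Fin n) ℂ) :
    wnorm w (f + g) ≤ wnorm w f + wnorm w g := by
  rw [wnorm, wnorm, wnorm, ← ENNReal.tsum_add]
  refine ENNReal.tsum_le_tsum fun m => ?_
  rw [map_add, ← add_mul]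
  gcongr
  exact enorm_add_le _ _

theorem wnorm_sum_le {ι : Type*} (w : Fin n → ℝ≥0∞) (s : Finset ι)
    (f : ι → MvPowerSeries (Fin n) ℂ) : wnorm w (∑ i ∈ s, f i) ≤ ∑ i ∈ s, wnorm w (f i) := by
  classical
  induction s using Finset.induction_on with
  | empty => simp [wnorm]
  | insert a s ha ih =>
    rw [Finset.sum_insert ha, Finset.sum_insert ha]
    exact (wnorm_add_le _ _ _).trans (by gcongr)

theorem wnorm_monomial (w : Fin n → ℝ≥0∞) (m : Fin n →₀ ℕ) (c : ℂ) :
    wnorm w (monomial m c) = ‖c‖ₑ * wt w m := by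
  classical
  rw [wnorm, tsum_eq_single m]
  · simp
  · intro b hb
    simp [coeff_monomial, hb]

theorem wnorm_C (w : Fin n → ℝ≥0∞) (c : ℂ) : wnorm w (C c) = ‖c‖ₑ := by
  rw [← monomial_zero_eq_C_apply, wnorm_monomial]; simp

theorem wnorm_one (w : Fin n → ℝ≥0∞) : wnorm w 1 = 1 := by
  rw [← map_one C, wnorm_C]; simp

theorem wnorm_X (w : Fin n → ℝ≥0∞) (i : Fin n) : wnorm w (X i) = w i := by
  rw [X_def, wnorm_monomial, wt_single]; simp

theorem tsum_mul_antidiagonal (a b : (Fin n →₀ ℕ) → ℝ≥0∞) :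
    ∑' m, ∑ p ∈ Finset.HasAntidiagonal.antidiagonal m, a p.1 * b p.2 = (∑' m, a m) * ∑' m, b m := by
  rw [← ENNReal.tsum_mul_right]
  simp_rw [← ENNReal.tsum_mul_left]
  rw [← ENNReal.tsum_prod (f := fun x y => a x * b y),
    ← Finset.HasAntidiagonal.sigmaAntidiagonalEquivProd.tsum_eq, ENNReal.tsum_sigma']
  refine tsum_congr fun m => ?_
  rw [tsum_fintype, Finset.univ_eq_attach, ← Finset.sum_attach]
  rfl

theorem wnorm_mul_le (w : Fin n → ℝ≥0∞) (f g : MvPowerSeries (Fin n) ℂ) :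
    wnorm w (f * g) ≤ wnorm w f * wnorm w g := by
  rw [wnorm, wnorm, wnorm, ← tsum_mul_antidiagonal]
  refine ENNReal.tsum_le_tsum fun m => ?_
  rw [coeff_mul]
  calc _ ≤ (∑ p ∈ Finset.HasAntidiagonal.antidiagonal m, ‖coeff p.1 f * coeff p.2 g‖ₑ) * wt w m := by
        gcongr; exact enorm_sum_le _ _
    _ = _ := by
        rw [Finset.sum_mul]
        refine Finset.sum_congr rfl fun p hp => ?_
        rw [← Finset.HasAntidiagonal.mem_antidiagonal.1 hp, wt_add, enorm_mul]
        ring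

theorem wnorm_pow_le (w : Fin n → ℝ≥0∞) (f : MvPowerSeries (Fin n) ℂ) (k : ℕ) :
    wnorm w (f ^ k) ≤ wnorm w f ^ k := by
  induction k with
  | zero => simp [wnorm_one]
  | succ k ih =>
    rw [pow_succ, pow_succ]
    exact (wnorm_mul_le _ _ _).trans (by gcongr)

theorem wnorm_prod_le {ι : Type*} (w : Fin n → ℝ≥0∞) (s : Finset ι)
    (f : ι → MvPowerSeries (Fin n) ℂ) : wnorm w (∏ i ∈ s, f i) ≤ ∏ i ∈ s, wnorm w (f i) := by
  classical
  induction s using Finset.induction_on with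
  | empty => simp [wnorm_one]
  | insert a s ha ih =>
    rw [Finset.prod_insert ha, Finset.prod_insert ha]
    exact (wnorm_mul_le _ _ _).trans (by gcongr)

/-- Every monomial that occurs has degree at least 1, so it picks up at least one factor t. -/
theorem wnorm_smul_wt_le {t : ℝ≥0∞} (ht : t ≤ 1) (hf : constantCoeff f = 0) :
    wnorm (fun i => t * w i) f ≤ t * wnorm w f := by
  rw [wnorm, wnorm, ← ENNReal.tsum_mul_left]
  refine ENNReal.tsum_le_tsum fun m => ?_
  rcases eq_or_ne m 0 with rfl | hm
  · simp [hf]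
  · have h1 : wt (fun i => t * w i) m = t ^ m.degree * wt w m := by
      simp [wt, mul_pow, Finset.prod_mul_distrib, Finset.prod_pow_eq_pow_sum,
        Finsupp.degree_eq_sum]
    rw [h1]
    have h2 : t ^ m.degree ≤ t :=
      pow_le_of_le_one zero_le ht (by simpa [Finsupp.degree_eq_zero_iff] using hm)
    calc _ = t ^ m.degree * (‖coeff m f‖ₑ * wt w m) := by ring
      _ ≤ _ := by gcongr

theorem eq_zero_of_wnorm_eq_zero (hw : ∀ i, w i ≠ 0) (h : wnorm w f = 0) : f = 0 := by
  ext m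
  have := ENNReal.tsum_eq_zero.1 h m
  simpa [wt_ne_zero hw m] using this

/-- A polydisc with arbitrary nonzero radii contains one with equal radii. Unequal weights are what
lets `exists_weight` shrink some variables and not x₀. -/
theorem convergent_iff :
    Convergent f ↔ ∃ w : Fin n → ℝ≥0∞, (∀ i, w i ≠ 0) ∧ wnorm w f ≠ ⊤ := by
  have key : ∀ r : ℝ, 0 < r → ((Summable fun m : Fin n →₀ ℕ => ‖coeff m f‖ * r ^ m.degree) ↔
      wnorm (fun _ => ENNReal.ofReal r) f ≠ ⊤) := by
    intro r hr
    have : wnorm (fun _ => ENNReal.ofReal r) f =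
        ∑' m : Fin n →₀ ℕ, ‖‖coeff m f‖ * r ^ m.degree‖ₑ := by
      refine tsum_congr fun m => ?_
      rw [enorm_mul, enorm_norm, wt, Finset.prod_pow_eq_pow_sum, Finsupp.degree_eq_sum, enorm_pow,
        Real.enorm_eq_ofReal hr.le]
    rw [this, tsum_enorm_ne_top_iff_summable_norm]
    refine summable_congr fun m => ?_
    rw [Real.norm_of_nonneg (by positivity)]
  constructor
  · rintro ⟨r, hr, h⟩
    exact ⟨_, fun i => by simpa using hr, (key r hr).1 h⟩
  · rintro ⟨w, hw, h⟩
    obtain ⟨r, hr, hrw⟩ : ∃ r : ℝ, 0 < r ∧ ∀ i, ENNReal.ofReal r ≤ w i := by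
      obtain ⟨t, ht0, ht⟩ : ∃ t : ℝ≥0∞, 0 < t ∧ ∀ i, t ≤ w i := by
        refine ⟨Finset.univ.inf w, ?_, fun i => Finset.inf_le (Finset.mem_univ i)⟩
        rw [Finset.lt_inf_iff (by simp)]
        exact fun i _ => pos_iff_ne_zero.2 (hw i)
      -- The minimum with 1 covers t = ⊤, which occurs when there are no variables or all weights
      -- are infinite.
      refine ⟨(min t 1).toReal, ENNReal.toReal_pos (by simp [ht0.ne']) (by simp), fun i => ?_⟩
      rw [ENNReal.ofReal_toReal (by simp)]
      exact (min_le_left _ _).trans (ht i)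
    exact ⟨r, hr, (key r hr).2 (ne_top_of_le_ne_top h (wnorm_mono hrw f))⟩

theorem exists_wnorm_le (hf : Convergent f) (hf0 : constantCoeff f = 0) {ε : ℝ≥0∞} (hε : ε ≠ 0) :
    ∃ w : Fin n → ℝ≥0∞, (∀ i, w i ≠ 0) ∧ wnorm w f ≤ ε := by
  obtain ⟨w, hw, h⟩ := convergent_iff.1 hf
  obtain ⟨t, ht0, ht⟩ := ENNReal.exists_nnreal_pos_mul_lt h hε
  have ht0' : min (t : ℝ≥0∞) 1 ≠ 0 := by simpa using ht0.ne'
  refine ⟨fun i => min (t : ℝ≥0∞) 1 * w i, fun i => mul_ne_zero ht0' (hw i), ?_⟩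
  refine (wnorm_smul_wt_le (min_le_right _ _) hf0).trans (le_trans ?_ ht.le)
  gcongr
  exact min_le_left _ _

/-! ### Substitution -/

/-- Submultiplicativity of the norm, applied to each monomial in the aᵢ. This one bound yields both
the convergence of a composite and the exchange of sums that computes its values. -/
theorem tsum_tsum_wnorm_le {p : ℕ} (a : Fin p → MvPowerSeries (Fin n) ℂ)
    (w : Fin n → ℝ≥0∞) (f : MvPowerSeries (Fin p) ℂ) :
    ∑' (d : Fin p →₀ ℕ) (e : Fin n →₀ ℕ),
      ‖coeff d f * coeff e (d.prod fun s e => a s ^ e)‖ₑ * wt w e ≤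
        wnorm (fun i => wnorm w (a i)) f := by
  refine ENNReal.tsum_le_tsum fun d => ?_
  simp_rw [enorm_mul, mul_assoc, ENNReal.tsum_mul_left]
  gcongr
  change wnorm w _ ≤ _
  rw [Finsupp.prod_fintype _ _ (by simp)]
  refine (wnorm_prod_le _ _ _).trans ?_
  exact Finset.prod_le_prod' fun i _ => wnorm_pow_le _ _ _

theorem coeff_subst_eq_tsum {p : ℕ} {a : Fin p → MvPowerSeries (Fin n) ℂ} (ha : HasSubst a)
    (f : MvPowerSeries (Fin p) ℂ) (e : Fin n →₀ ℕ) :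
    coeff e (subst a f) = ∑' d : Fin p →₀ ℕ, coeff d f * coeff e (d.prod fun s e => a s ^ e) := by
  rw [coeff_subst ha, ← tsum_eq_finsum (L := .unconditional _) (coeff_subst_finite ha f e)]
  rfl

theorem wnorm_subst {p : ℕ} {a : Fin p → MvPowerSeries (Fin n) ℂ} (ha : HasSubst a)
    (w : Fin n → ℝ≥0∞) (f : MvPowerSeries (Fin p) ℂ) :
    wnorm w (subst a f) ≤ wnorm (fun i => wnorm w (a i)) f := by
  refine le_trans ?_ (tsum_tsum_wnorm_le a w f)
  rw [ENNReal.tsum_comm]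
  refine ENNReal.tsum_le_tsum fun e => ?_
  rw [ENNReal.tsum_mul_right, coeff_subst_eq_tsum ha]
  gcongr
  exact enorm_tsum_le_tsum_enorm

/-- As aᵢ has no constant term, its norm is at most the radius vᵢ on a small polydisc; the
intersection of these polydiscs works. -/
theorem Convergent.subst {p : ℕ} {a : Fin p → MvPowerSeries (Fin n) ℂ}
    (ha : ∀ i, Convergent (a i)) (ha0 : ∀ i, constantCoeff (a i) = 0)
    {f : MvPowerSeries (Fin p) ℂ} (hf : Convergent f) : Convergent (subst a f) := by
  obtain ⟨v, hv, hfv⟩ := convergent_iff.1 hf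
  choose w hw hwa using fun i => exists_wnorm_le (ha i) (ha0 i) (hv i)
  rw [convergent_iff]
  refine ⟨fun j => Finset.univ.inf fun i => w i j, fun j => ?_, ?_⟩
  · rw [← pos_iff_ne_zero, Finset.lt_inf_iff (by simp)]
    exact fun i _ => pos_iff_ne_zero.2 (hw i j)
  · refine ne_top_of_le_ne_top hfv ((wnorm_subst (hasSubst_of_constantCoeff_zero ha0) _ f).trans ?_)
    refine wnorm_mono (fun i => le_trans (wnorm_mono (fun j => ?_) _) (hwa i)) f
    exact Finset.inf_le (Finset.mem_univ i)

end wnorm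

/-! ### Values -/

/-- The sum of a power series at a point. -/
def sumAt {n : ℕ} (f : MvPowerSeries (Fin n) ℂ) (z : Fin n → ℂ) : ℂ :=
  ∑' m : Fin n →₀ ℕ, coeff m f * m.prod (z · ^ ·)

/-- Absolute convergence of a power series at a point. -/
def ConvergesAt {n : ℕ} (f : MvPowerSeries (Fin n) ℂ) (z : Fin n → ℂ) : Prop :=
  wnorm (fun i => ‖z i‖ₑ) f ≠ ⊤

section value

variable {n : ℕ} {f g : MvPowerSeries (Fin n) ℂ} {z : Fin n → ℂ}

theorem value_eq_sumAt (f : convSeries n) (z : Fin n → ℂ) : value f z = sumAt f z := rfl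

theorem enorm_monomial_eval (m : Fin n →₀ ℕ) (z : Fin n → ℂ) :
    ‖m.prod (z · ^ ·)‖ₑ = wt (fun i => ‖z i‖ₑ) m := by
  rw [Finsupp.prod_fintype _ _ (by simp), wt]
  simp [enorm_eq_nnnorm, nnnorm_prod]

theorem wnorm_enorm_eq (f : MvPowerSeries (Fin n) ℂ) (z : Fin n → ℂ) :
    wnorm (fun i => ‖z i‖ₑ) f = ∑' m : Fin n →₀ ℕ, ‖coeff m f * m.prod (z · ^ ·)‖ₑ :=
  tsum_congr fun m => by rw [enorm_mul, enorm_monomial_eval]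

theorem ConvergesAt.summable_norm (h : ConvergesAt f z) :
    Summable fun m : Fin n →₀ ℕ => ‖coeff m f * m.prod (z · ^ ·)‖ := by
  rw [ConvergesAt, wnorm_enorm_eq] at h
  exact tsum_enorm_ne_top_iff_summable_norm.1 h

theorem ConvergesAt.summable (h : ConvergesAt f z) :
    Summable fun m : Fin n →₀ ℕ => coeff m f * m.prod (z · ^ ·) :=
  h.summable_norm.of_norm

theorem ConvergesAt.add (hf : ConvergesAt f z) (hg : ConvergesAt g z) : ConvergesAt (f + g) z :=
  ne_top_of_le_ne_top (ENNReal.add_ne_top.2 ⟨hf, hg⟩) (wnorm_add_le _ _ _)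

theorem ConvergesAt.mul (hf : ConvergesAt f z) (hg : ConvergesAt g z) : ConvergesAt (f * g) z :=
  ne_top_of_le_ne_top (ENNReal.mul_ne_top hf hg) (wnorm_mul_le _ _ _)

theorem convergesAt_C (c : ℂ) : ConvergesAt (C c) z := by simp [ConvergesAt, wnorm_C]

theorem convergesAt_X (i : Fin n) : ConvergesAt (X i) z := by simp [ConvergesAt, wnorm_X]

theorem sumAt_C (c : ℂ) : sumAt (C c) z = c := by
  classical
  rw [sumAt, tsum_eq_single 0]
  · simp
  · intro m hm
    simp [coeff_C, hm]

theorem sumAt_X (i : Fin n) : sumAt (X i) z = z i := by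
  classical
  rw [sumAt, tsum_eq_single (Finsupp.single i 1)]
  · simp
  · intro m hm
    simp [coeff_X, hm]

theorem sumAt_add (hf : ConvergesAt f z) (hg : ConvergesAt g z) :
    sumAt (f + g) z = sumAt f z + sumAt g z := by
  rw [sumAt, sumAt, sumAt, ← hf.summable.tsum_add hg.summable]
  simp [add_mul]

theorem sumAt_mul (hf : ConvergesAt f z) (hg : ConvergesAt g z) :
    sumAt (f * g) z = sumAt f z * sumAt g z := by
  have h := summable_mul_of_summable_norm hf.summable_norm hg.summable_norm
  rw [sumAt, sumAt, sumAt, hf.summable.tsum_mul_tsum_eq_tsum_sum_antidiagonal hg.summable h]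
  refine tsum_congr fun m => ?_
  rw [coeff_mul, Finset.sum_mul]
  refine Finset.sum_congr rfl fun p hp => ?_
  rw [← Finset.HasAntidiagonal.mem_antidiagonal.1 hp, Finsupp.prod_add_index' (by simp)
    (fun _ _ _ => pow_add _ _ _)]
  ring

theorem convergesAt_pow (hf : ConvergesAt f z) (k : ℕ) : ConvergesAt (f ^ k) z :=
  ne_top_of_le_ne_top (ENNReal.pow_ne_top hf) (wnorm_pow_le _ _ _)

theorem sumAt_pow (hf : ConvergesAt f z) (k : ℕ) : sumAt (f ^ k) z = sumAt f z ^ k := by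
  induction k with
  | zero => simpa using sumAt_C (z := z) 1
  | succ k ih => rw [pow_succ, pow_succ, sumAt_mul (convergesAt_pow hf k) hf, ih]

theorem sumAt_prod {ι : Type*} (s : Finset ι) (a : ι → MvPowerSeries (Fin n) ℂ)
    (ha : ∀ i ∈ s, ConvergesAt (a i) z) :
    ConvergesAt (∏ i ∈ s, a i) z ∧ sumAt (∏ i ∈ s, a i) z = ∏ i ∈ s, sumAt (a i) z := by
  classical
  induction s using Finset.induction_on with
  | empty => exact ⟨by simpa using convergesAt_C (z := z) 1, by simpa using sumAt_C (z := z) 1⟩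
  | insert b s hb ih =>
    obtain ⟨h1, h2⟩ := ih fun i hi => ha i (Finset.mem_insert_of_mem hi)
    have h3 := ha b (Finset.mem_insert_self b s)
    rw [Finset.prod_insert hb, Finset.prod_insert hb]
    exact ⟨h3.mul h1, by rw [sumAt_mul h3 h1, h2]⟩

theorem sumAt_subst {p : ℕ} {a : Fin p → MvPowerSeries (Fin n) ℂ} (ha : HasSubst a)
    (haz : ∀ i, ConvergesAt (a i) z) {f : MvPowerSeries (Fin p) ℂ}
    (hf : wnorm (fun i => wnorm (fun j => ‖z j‖ₑ) (a i)) f ≠ ⊤) :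
    sumAt (subst a f) z = sumAt f fun i => sumAt (a i) z := by
  have h1 : Summable (Function.uncurry fun (d : Fin p →₀ ℕ) (e : Fin n →₀ ℕ) =>
      coeff d f * coeff e (d.prod fun s e => a s ^ e) * e.prod (z · ^ ·)) := by
    refine Summable.of_enorm ?_
    refine ne_top_of_le_ne_top hf (le_trans (le_of_eq ?_) (tsum_tsum_wnorm_le a _ f))
    rw [ENNReal.tsum_prod']
    refine tsum_congr fun d => tsum_congr fun e => ?_
    simp only [Function.uncurry]
    rw [enorm_mul, enorm_monomial_eval]
  rw [sumAt]
  simp_rw [coeff_subst_eq_tsum ha, ← tsum_mul_right]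
  rw [h1.tsum_comm, sumAt]
  refine tsum_congr fun d => ?_
  simp_rw [mul_assoc]
  rw [tsum_mul_left]
  congr 1
  change sumAt _ z = _
  rw [Finsupp.prod_fintype _ _ (by simp), Finsupp.prod_fintype _ _ (by simp),
    (sumAt_prod _ _ fun i _ => convergesAt_pow (haz i) _).2]
  exact Finset.prod_congr rfl fun i _ => sumAt_pow (haz i) _

/-! ### Values near the origin -/

theorem eventually_convergesAt (f : convSeries n) :
    ∀ᶠ z in 𝓝 (0 : Fin n → ℂ), ConvergesAt (f : MvPowerSeries (Fin n) ℂ) z := by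
  obtain ⟨w, hw, h⟩ := convergent_iff.1 f.2
  have : ∀ᶠ z in 𝓝 (0 : Fin n → ℂ), ∀ i, ‖z i‖ₑ < w i := by
    rw [eventually_all]
    intro i
    have hc : Continuous fun z : Fin n → ℂ => ‖z i‖ₑ := by fun_prop
    exact hc.continuousAt.eventually_lt continuousAt_const (by simpa using pos_iff_ne_zero.2 (hw i))
  filter_upwards [this] with z hz
  exact ne_top_of_le_ne_top h (wnorm_mono (fun i => (hz i).le) _)

theorem eventually_value_add (f g : convSeries n) :
    ∀ᶠ z in 𝓝 (0 : Fin n → ℂ), value (f + g) z = value f z + value g z := by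
  filter_upwards [eventually_convergesAt f, eventually_convergesAt g] with z h1 h2
  exact sumAt_add h1 h2

theorem eventually_value_mul (f g : convSeries n) :
    ∀ᶠ z in 𝓝 (0 : Fin n → ℂ), value (f * g) z = value f z * value g z := by
  filter_upwards [eventually_convergesAt f, eventually_convergesAt g] with z h1 h2
  exact sumAt_mul h1 h2

theorem value_zero_left (z : Fin n → ℂ) : value (0 : convSeries n) z = 0 := by
  simp [value]

theorem value_at_zero (f : convSeries n) :
    value f 0 = constantCoeff (f : MvPowerSeries (Fin n) ℂ) := by
  rw [value, tsum_eq_single 0]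
  · simp
  · intro m hm
    obtain ⟨i, hi⟩ := Finsupp.ne_iff.1 hm
    rw [Finsupp.prod_fintype _ _ (by simp), Finset.prod_eq_zero (Finset.mem_univ i), mul_zero]
    simpa using hi

end value

/-! ### The identity theorem -/

/-- Restrict to the lines t ↦ t a. The Taylor coefficients in t are the homogeneous parts p_d of f
evaluated at a; they vanish for every a, so each polynomial p_d is zero. -/
theorem eq_zero_of_eventually_value_eq_zero {n : ℕ} {f : convSeries n}
    (h : ∀ᶠ z in 𝓝 (0 : Fin n → ℂ), value f z = 0) : f = 0 := by
  let p : ℕ → MvPolynomial (Fin n) ℂ := fun d =>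
    ∑ m ∈ Finset.finsuppAntidiag Finset.univ d,
      MvPolynomial.monomial m (coeff m (f : MvPowerSeries (Fin n) ℂ))
  have hmem : ∀ (m : Fin n →₀ ℕ) (d : ℕ),
      m ∈ Finset.finsuppAntidiag Finset.univ d ↔ m.degree = d := by
    intro m d
    simp [Finset.mem_finsuppAntidiag, Finsupp.degree_eq_sum]
  have hp : ∀ d, p d = 0 := by
    intro d
    refine MvPolynomial.funext fun a => ?_
    rw [map_zero]
    have hlim : Tendsto (fun t : ℂ => t • a) (𝓝 0) (𝓝 0) := by
      have : Continuous fun t : ℂ => t • a := by fun_prop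
      simpa using this.tendsto 0
    let P : FormalMultilinearSeries ℂ ℂ ℂ :=
      FormalMultilinearSeries.ofScalars ℂ fun d => MvPolynomial.eval a (p d)
    have hP : HasFPowerSeriesAt (0 : ℂ → ℂ) P 0 := by
      rw [hasFPowerSeriesAt_iff]
      filter_upwards [hlim.eventually h, hlim.eventually (eventually_convergesAt f)] with t h1 h2
      have h3 := h2.summable.hasSum
      rw [← sumAt, ← value_eq_sumAt, h1] at h3
      -- The absolutely convergent sum is regrouped by total degree, which exhibits the power series
      -- in t.
      have h4 := ((Equiv.sigmaFiberEquiv (Finsupp.degree : (Fin n →₀ ℕ) → ℕ)).hasSum_iff.2 h3).sigma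
        (g := fun d => t ^ d • P.coeff d) ?_
      · simpa using h4
      intro d
      have h5 : ∀ m : Fin n →₀ ℕ, m.prod ((t • a) · ^ ·) = t ^ m.degree * m.prod (a · ^ ·) := by
        intro m
        rw [Finsupp.prod_fintype _ _ (by simp), Finsupp.prod_fintype _ _ (by simp)]
        simp [mul_pow, Finset.prod_mul_distrib, Finset.prod_pow_eq_pow_sum, Finsupp.degree_eq_sum]
      have h6 : t ^ d • P.coeff d = ∑ m ∈ Finset.finsuppAntidiag Finset.univ d,
          coeff m (f : MvPowerSeries (Fin n) ℂ) * m.prod ((t • a) · ^ ·) := by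
        simp only [P, FormalMultilinearSeries.coeff_ofScalars, p, map_sum,
          MvPolynomial.eval_monomial, smul_eq_mul, Finset.mul_sum]
        refine Finset.sum_congr rfl fun m hm => ?_
        rw [h5, (hmem m d).1 hm]
        ring
      rw [h6]
      let e : {m : Fin n →₀ ℕ // m.degree = d} ≃
          {m // m ∈ (Finset.finsuppAntidiag (Finset.univ : Finset (Fin n)) d)} :=
        Equiv.subtypeEquivRight fun m => (hmem m d).symm
      have h8 := e.hasSum_iff.2 ((Finset.finsuppAntidiag Finset.univ d).hasSum
        (fun m : Fin n →₀ ℕ => coeff m (f : MvPowerSeries (Fin n) ℂ) * m.prod ((t • a) · ^ ·)))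
      exact h8
    have h9 := hP.eq_zero
    have h10 : P.coeff d = 0 := by rw [h9]; rfl
    simpa [P] using h10
  refine Subtype.ext (MvPowerSeries.ext fun m => ?_)
  have := congrArg (MvPolynomial.coeff m) (hp m.degree)
  simpa [p, MvPolynomial.coeff_sum, MvPolynomial.coeff_monomial, hmem] using this

/-! ### A fixed point lemma -/

/-- The power series with coefficients `f_{m + s}`. -/
def shift {n : ℕ} (s : Fin n →₀ ℕ) (f : MvPowerSeries (Fin n) ℂ) : MvPowerSeries (Fin n) ℂ :=
  fun m => coeff (m + s) f

section shift

variable {n : ℕ} {w : Fin n → ℝ≥0∞} {s : Fin n →₀ ℕ}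

theorem coeff_shift (s : Fin n →₀ ℕ) (f : MvPowerSeries (Fin n) ℂ) (m) :
    coeff m (shift s f) = coeff (m + s) f := rfl

theorem shift_sub (s : Fin n →₀ ℕ) (f g : MvPowerSeries (Fin n) ℂ) :
    shift s (f - g) = shift s f - shift s g := by
  ext m; simp [coeff_shift]

theorem wt_mul_wnorm_shift_le (w : Fin n → ℝ≥0∞) (s : Fin n →₀ ℕ)
    (f : MvPowerSeries (Fin n) ℂ) : wt w s * wnorm w (shift s f) ≤ wnorm w f := by
  rw [wnorm, ← ENNReal.tsum_mul_left]
  have : ∀ m : Fin n →₀ ℕ, wt w s * (‖coeff m (shift s f)‖ₑ * wt w m) =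
      ‖coeff (m + s) f‖ₑ * wt w (m + s) := by
    intro m
    rw [coeff_shift, wt_add]; ring
  simp_rw [this]
  exact ENNReal.tsum_comp_le_tsum_of_injective (add_left_injective s)
    fun m => ‖coeff m f‖ₑ * wt w m

theorem Convergent.shift {f : MvPowerSeries (Fin n) ℂ} (hf : Convergent f) (s : Fin n →₀ ℕ) :
    Convergent (shift s f) := by
  obtain ⟨w, hw, h⟩ := convergent_iff.1 hf
  refine convergent_iff.2 ⟨w, hw, fun htop => h ?_⟩
  have := wt_mul_wnorm_shift_le w s f
  rw [htop, ENNReal.mul_top (wt_ne_zero hw s)] at this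
  exact top_le_iff.1 this

/-- The operator Q ↦ `shift s (Q * W)` contracts by 1/2: multiplication by W costs ‖W‖, and the
shift gains the inverse of the weight of x^s. -/
theorem two_mul_wnorm_shift_mul_le (hw0 : ∀ i, w i ≠ 0) (hwt : ∀ i, w i ≠ ⊤)
    {W : MvPowerSeries (Fin n) ℂ} (hW : 2 * wnorm w W ≤ wt w s) (Q : MvPowerSeries (Fin n) ℂ) :
    2 * wnorm w (shift s (Q * W)) ≤ wnorm w Q := by
  rw [← ENNReal.mul_le_mul_iff_right (wt_ne_zero hw0 s) (wt_ne_top hwt s)]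
  calc wt w s * (2 * wnorm w (shift s (Q * W)))
      = 2 * (wt w s * wnorm w (shift s (Q * W))) := by ring
    _ ≤ 2 * (wnorm w Q * wnorm w W) := by
        exact mul_le_mul_right ((wt_mul_wnorm_shift_le _ _ _).trans (wnorm_mul_le _ _ _)) _
    _ = wnorm w Q * (2 * wnorm w W) := by ring
    _ ≤ wnorm w Q * wt w s := by gcongr
    _ = _ := mul_comm _ _

/-- Neumann series: Q is the sum of the iterates T k of the contraction at F, taken coefficient by
coefficient. -/
theorem exists_eq_add_shift_mul (hw0 : ∀ i, w i ≠ 0) (hwt : ∀ i, w i ≠ ⊤)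
    {W : MvPowerSeries (Fin n) ℂ} (hW : 2 * wnorm w W ≤ wt w s) {F : MvPowerSeries (Fin n) ℂ}
    (hF : wnorm w F ≠ ⊤) : ∃ Q, wnorm w Q ≠ ⊤ ∧ Q = F + shift s (Q * W) := by
  obtain ⟨T, hT0, hT⟩ : ∃ T : ℕ → MvPowerSeries (Fin n) ℂ, T 0 = F ∧
      ∀ k, T (k + 1) = shift s (T k * W) :=
    ⟨fun k => (fun Q => shift s (Q * W))^[k] F, rfl, fun k => Function.iterate_succ_apply' _ _ _⟩
  have hTn : ∀ k, wnorm w (T k) ≤ 2⁻¹ ^ k * wnorm w F := by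
    intro k
    induction k with
    | zero => simp [hT0]
    | succ k ih =>
      have h1 := two_mul_wnorm_shift_mul_le hw0 hwt hW (T k)
      rw [← hT] at h1
      calc wnorm w (T (k + 1)) = 2⁻¹ * (2 * wnorm w (T (k + 1))) := by
            rw [← mul_assoc, ENNReal.inv_mul_cancel (by simp) (by simp), one_mul]
        _ ≤ 2⁻¹ * (2⁻¹ ^ k * wnorm w F) := mul_le_mul_right (h1.trans ih) _
        _ = _ := by ring
  have hsum : ∑' k, wnorm w (T k) ≠ ⊤ := by
    refine ne_top_of_le_ne_top ?_ (ENNReal.tsum_le_tsum hTn)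
    rw [ENNReal.tsum_mul_right, ENNReal.tsum_geometric]
    exact ENNReal.mul_ne_top (by simp) hF
  have hsm : ∀ m, Summable fun k => coeff m (T k) := by
    intro m
    refine Summable.of_enorm fun htop => hsum (top_le_iff.1 ?_)
    calc (⊤ : ℝ≥0∞) = (∑' k, ‖coeff m (T k)‖ₑ) * wt w m := by
          rw [htop, ENNReal.top_mul (wt_ne_zero hw0 m)]
      _ = ∑' k, ‖coeff m (T k)‖ₑ * wt w m := by rw [ENNReal.tsum_mul_right]
      _ ≤ _ := ENNReal.tsum_le_tsum fun k => coeff_mul_wt_le_wnorm w (T k) m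
  obtain ⟨Q, hQ⟩ : ∃ Q : MvPowerSeries (Fin n) ℂ, ∀ m, coeff m Q = ∑' k, coeff m (T k) :=
    ⟨fun m => ∑' k, coeff m (T k), fun m => rfl⟩
  refine ⟨Q, ne_top_of_le_ne_top hsum ?_, MvPowerSeries.ext fun m => ?_⟩
  · simp_rw [wnorm]
    rw [ENNReal.tsum_comm]
    refine ENNReal.tsum_le_tsum fun m => ?_
    rw [ENNReal.tsum_mul_right, hQ]
    gcongr
    exact enorm_tsum_le_tsum_enorm
  · rw [map_add, coeff_shift, coeff_mul]
    have h1 : ∑ p ∈ Finset.HasAntidiagonal.antidiagonal (m + s), coeff p.1 Q * coeff p.2 W =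
        ∑' k, ∑ p ∈ Finset.HasAntidiagonal.antidiagonal (m + s),
          coeff p.1 (T k) * coeff p.2 W := by
      have h2 : ∀ p ∈ Finset.HasAntidiagonal.antidiagonal (m + s),
          HasSum (fun k => coeff p.1 (T k) * coeff p.2 W) (coeff p.1 Q * coeff p.2 W) := by
        intro p _
        rw [hQ]
        exact (hsm p.1).hasSum.mul_right (coeff p.2 W)
      exact (hasSum_sum h2).tsum_eq.symm
    rw [h1, hQ, (hsm m).tsum_eq_zero_add, hT0]
    congr 1
    refine tsum_congr fun k => ?_
    rw [hT, coeff_shift, coeff_mul]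

end shift

/-! ### Units -/

section units

variable {n : ℕ}

theorem Convergent.sub {f g : MvPowerSeries (Fin n) ℂ} (hf : Convergent f) (hg : Convergent g) :
    Convergent (f - g) :=
  (convSeries n).sub_mem hf hg

theorem convergent_X (i : Fin n) : Convergent (X i : MvPowerSeries (Fin n) ℂ) :=
  convergent_iff.2 ⟨fun _ => 1, by simp, by simp [wnorm_X]⟩

/-- The case s = 0 of the fixed point: Q = 1 + Q (1 − f / c) says that (Q / c) f = 1. -/
theorem Convergent.exists_inv {f : MvPowerSeries (Fin n) ℂ} (hf : Convergent f)
    (h0 : constantCoeff f ≠ 0) : ∃ g, Convergent g ∧ f * g = 1 := by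
  set c := constantCoeff f with hc
  have hcc : Convergent (C c⁻¹ : MvPowerSeries (Fin n) ℂ) := Convergent.const c⁻¹
  have hW : Convergent (1 - C c⁻¹ * f) := Convergent.sub (convSeries n).one_mem (hcc.mul hf)
  obtain ⟨w, hw, hwW⟩ := exists_wnorm_le hW (by simp [← hc, h0]) (ε := 2⁻¹) (by simp)
  have hw' : ∀ i, min (w i) 1 ≠ 0 := fun i => by simpa using hw i
  obtain ⟨Q, hQ, hQe⟩ := exists_eq_add_shift_mul (w := fun i => min (w i) 1) (s := 0)
    (W := 1 - C c⁻¹ * f) (F := 1) hw' (fun i => by simp) (by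
      rw [wt_zero]
      calc _ ≤ 2 * (2⁻¹ : ℝ≥0∞) := by
            gcongr
            exact (wnorm_mono (fun i => min_le_left _ _) _).trans hwW
        _ = 1 := ENNReal.mul_inv_cancel (by simp) (by simp)) (by simp [wnorm_one])
  have hs : ∀ g : MvPowerSeries (Fin n) ℂ, ConvSeries.shift 0 g = g := fun g => by
    ext m; simp [coeff_shift]
  rw [hs] at hQe
  refine ⟨C c⁻¹ * Q, hcc.mul (convergent_iff.2 ⟨_, hw', hQ⟩), ?_⟩
  linear_combination hQe

theorem isUnit_iff (f : convSeries n) :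
    IsUnit f ↔ constantCoeff (f : MvPowerSeries (Fin n) ℂ) ≠ 0 := by
  constructor
  · intro h
    exact ((h.map (convSeries n).val).map (constantCoeff (σ := Fin n) (R := ℂ))).ne_zero
  · intro h
    obtain ⟨g, hg, hfg⟩ := Convergent.exists_inv f.2 h
    exact IsUnit.of_mul_eq_one (⟨g, hg⟩ : convSeries n) (Subtype.ext hfg)

end units

/-! ### Weierstrass division -/

/-- `h` is regular of order `d` in the variable `x₀`. -/
def IsRegular {n : ℕ} (h : MvPowerSeries (Fin (n + 1)) ℂ) (d : ℕ) : Prop :=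
  (∀ k < d, coeff (Finsupp.single 0 k) h = 0) ∧ coeff (Finsupp.single 0 d) h ≠ 0

section division

variable {n : ℕ} {h : MvPowerSeries (Fin (n + 1)) ℂ} {d : ℕ}

theorem shift_X_pow_mul (Q : MvPowerSeries (Fin (n + 1)) ℂ) (d : ℕ) :
    shift (Finsupp.single 0 d) (X 0 ^ d * Q) = Q := by
  ext m
  rw [coeff_shift, X_pow_eq, add_comm m, coeff_add_monomial_mul, one_mul]

/-- Since W vanishes on the x₀-axis, each of its monomials contains some other variable. Shrinking
those variables makes ‖W‖ small without changing the weight of x₀^d. -/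
theorem exists_weight {W F : MvPowerSeries (Fin (n + 1)) ℂ} (hW : Convergent W)
    (hF : Convergent F) (hW0 : ∀ k, coeff (Finsupp.single 0 k) W = 0) (d : ℕ) :
    ∃ w : Fin (n + 1) → ℝ≥0∞, (∀ i, w i ≠ 0) ∧ (∀ i, w i ≠ ⊤) ∧ wnorm w F ≠ ⊤ ∧
      2 * wnorm w W ≤ wt w (Finsupp.single 0 d) := by
  obtain ⟨w₁, hw₁, h₁⟩ := convergent_iff.1 hW
  obtain ⟨w₂, hw₂, h₂⟩ := convergent_iff.1 hF
  let w : Fin (n + 1) → ℝ≥0∞ := fun i => min 1 (min (w₁ i) (w₂ i))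
  have hw0 : ∀ i, w i ≠ 0 := fun i => by simp [w, hw₁, hw₂]
  have hwt : ∀ i, w i ≠ ⊤ := fun i => by simp [w]
  have hwW : wnorm w W ≠ ⊤ := ne_top_of_le_ne_top h₁
    (wnorm_mono (fun i => (min_le_right _ _).trans (min_le_left _ _)) _)
  have hwF : wnorm w F ≠ ⊤ := ne_top_of_le_ne_top h₂
    (wnorm_mono (fun i => (min_le_right _ _).trans (min_le_right _ _)) _)
  obtain ⟨t, ht0, ht⟩ := ENNReal.exists_nnreal_pos_mul_lt
    (ENNReal.mul_ne_top (ENNReal.ofNat_ne_top (n := 2)) hwW) (pow_ne_zero d (hw0 0))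
  let τ : ℝ≥0∞ := min t 1
  have hτ0 : τ ≠ 0 := by simpa [τ] using ht0.ne'
  let v : Fin (n + 1) → ℝ≥0∞ := fun i => if i = 0 then w i else τ * w i
  have hvw : ∀ i, v i ≤ w i := by
    intro i
    by_cases hi : i = 0
    · simp [v, hi]
    · simp only [v, hi, if_false]
      exact mul_le_of_le_one_left' (min_le_right _ _)
  refine ⟨v, fun i => ?_, fun i => ne_top_of_le_ne_top (hwt i) (hvw i),
    ne_top_of_le_ne_top hwF (wnorm_mono hvw F), ?_⟩
  · by_cases hi : i = 0
    · simpa [v, hi] using hw0 0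
    · simpa [v, hi] using ⟨hτ0, hw0 i⟩
  · have h3 : wnorm v W ≤ τ * wnorm w W := by
      rw [wnorm, wnorm, ← ENNReal.tsum_mul_left]
      refine ENNReal.tsum_le_tsum fun m => ?_
      by_cases hm : ∀ i, i ≠ 0 → m i = 0
      · have : m = Finsupp.single 0 (m 0) := by
          ext i
          by_cases hi : i = 0
          · simp [hi]
          · simp [hm i hi, Ne.symm hi]
        rw [this, hW0]
        simp
      · push Not at hm
        obtain ⟨i, hi, hmi⟩ := hm
        have hle : Finsupp.single i 1 ≤ m := by
          simpa using Nat.one_le_iff_ne_zero.2 hmi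
        obtain ⟨m', rfl⟩ := exists_add_of_le hle
        rw [wt_add, wt_add, wt_single, wt_single, pow_one, pow_one]
        have hvi : v i = τ * w i := by simp [v, hi]
        rw [hvi]
        calc _ = τ * (‖coeff (Finsupp.single i 1 + m') W‖ₑ * (w i * wt v m')) := by ring
          _ ≤ _ := by gcongr; exact wt_mono hvw m'
    have hv0 : v 0 = w 0 := by simp [v]
    rw [wt_single, hv0]
    calc 2 * wnorm v W ≤ 2 * (τ * wnorm w W) := by gcongr
      _ = τ * (2 * wnorm w W) := by ring
      _ ≤ t * (2 * wnorm w W) := by gcongr; exact min_le_left _ _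
      _ ≤ _ := ht.le

/-- Write h = x₀^d u + (terms of degree < d in x₀). The constant term of u is the coefficient of
x₀^d in h, so u is a unit, and by regularity the remaining terms vanish on the x₀-axis. Then v = u⁻¹
and W = x₀^d − h v. -/
theorem IsRegular.exists_unit (hr : IsRegular h d) (hh : Convergent h) :
    ∃ u v W : MvPowerSeries (Fin (n + 1)) ℂ, Convergent u ∧ Convergent v ∧ Convergent W ∧
      u * v = 1 ∧ h * v = X 0 ^ d - W ∧ ∀ k, coeff (Finsupp.single 0 k) W = 0 := by
  have hu := hh.shift (Finsupp.single 0 d)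
  have hu0 : constantCoeff (shift (Finsupp.single 0 d) h) ≠ 0 := by
    rw [← coeff_zero_eq_constantCoeff_apply, coeff_shift, zero_add]
    exact hr.2
  obtain ⟨v, hv, huv⟩ := hu.exists_inv hu0
  set u := shift (Finsupp.single 0 d) h with hu_def
  have hX : Convergent ((X 0 : MvPowerSeries (Fin (n + 1)) ℂ) ^ d) :=
    (convSeries (n + 1)).pow_mem (convergent_X 0) d
  refine ⟨u, v, X 0 ^ d - h * v, hu, hv, hX.sub (hh.mul hv), huv, by ring, fun k => ?_⟩
  have hP : X 0 ^ d - h * v = (X 0 ^ d * u - h) * v := by linear_combination (-X 0 ^ d) * huv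
  rw [hP, coeff_mul]
  refine Finset.sum_eq_zero fun p hp => ?_
  have hp' := Finset.HasAntidiagonal.mem_antidiagonal.1 hp
  have hp1 : p.1 = Finsupp.single 0 (p.1 0) := by
    ext i
    by_cases hi : i = 0
    · simp [hi]
    · have := DFunLike.congr_fun hp' i
      simp [Ne.symm hi] at this
      simp [this.1, Ne.symm hi]
  rw [hp1]
  generalize p.1 0 = j
  have : coeff (Finsupp.single 0 j) (X 0 ^ d * u - h) = 0 := by
    rw [map_sub, X_pow_eq, coeff_monomial_mul]
    by_cases hj : d ≤ j
    · rw [if_pos (by simpa using hj), hu_def, coeff_shift, one_mul,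
        tsub_add_cancel_of_le (by simpa using hj), sub_self]
    · rw [if_neg (by simpa using hj), hr.1 j (not_le.1 hj), sub_zero]
  rw [this, zero_mul]

/-- Weierstrass division: existence. -/
theorem IsRegular.exists_div (hr : IsRegular h d) (hh : Convergent h)
    {F : MvPowerSeries (Fin (n + 1)) ℂ} (hF : Convergent F) :
    ∃ q r, Convergent q ∧ Convergent r ∧ F = q * h + r ∧ ∀ m, d ≤ m 0 → coeff m r = 0 := by
  obtain ⟨u, v, W, hu, hv, hW, huv, hhv, hW0⟩ := hr.exists_unit hh
  obtain ⟨w, hw0, hwt, hwF, hwW⟩ := exists_weight hW (hF.shift (Finsupp.single 0 d)) hW0 d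
  -- With quotient v Q, the remainder is F − x₀^d Q + Q W. Its shift by x₀^d vanishes exactly when Q
  -- solves this fixed point equation.
  obtain ⟨Q, hQ, hQe⟩ := exists_eq_add_shift_mul hw0 hwt hwW hwF
  have hQc : Convergent Q := convergent_iff.2 ⟨w, hw0, hQ⟩
  refine ⟨v * Q, F - v * Q * h, hv.mul hQc, hF.sub ((hv.mul hQc).mul hh), by ring, fun m hm => ?_⟩
  have h1 : shift (Finsupp.single 0 d) (F - v * Q * h) = 0 := by
    have : v * Q * h = X 0 ^ d * Q - Q * W := by linear_combination Q * hhv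
    rw [this, shift_sub, shift_sub, shift_X_pow_mul]
    linear_combination -hQe
  have hle : Finsupp.single 0 d ≤ m := by simpa using hm
  obtain ⟨m', rfl⟩ := exists_add_of_le hle
  rw [add_comm _ m', ← coeff_shift, h1, map_zero]

/-- Weierstrass division: uniqueness. -/
theorem IsRegular.eq_zero_of_mul_eq (hr : IsRegular h d) (hh : Convergent h)
    {q r : MvPowerSeries (Fin (n + 1)) ℂ} (hq : Convergent q) (hqr : q * h = r)
    (hrd : ∀ m, d ≤ m 0 → coeff m r = 0) : q = 0 := by
  obtain ⟨u, v, W, hu, hv, hW, huv, hhv, hW0⟩ := hr.exists_unit hh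
  obtain ⟨w, hw0, hwt, hwQ, hwW⟩ := exists_weight hW (hq.mul hu) hW0 d
  have h1 : shift (Finsupp.single 0 d) r = 0 := by
    ext m
    rw [coeff_shift, hrd _ (by simp), map_zero]
  have h2 : r = X 0 ^ d * (q * u) - q * u * W := by
    linear_combination -hqr - q * h * huv + q * u * hhv
  rw [h2, shift_sub, shift_X_pow_mul] at h1
  -- Now q u is a fixed point of a linear contraction and has finite norm, so it is zero.
  have h3 := two_mul_wnorm_shift_mul_le hw0 hwt hwW (q * u)
  rw [← sub_eq_zero.1 h1] at h3
  have h4 : wnorm w (q * u) = 0 := by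
    by_contra h0
    have : wnorm w (q * u) * 2 ≤ wnorm w (q * u) * 1 := by rwa [mul_one, mul_comm]
    rw [ENNReal.mul_le_mul_iff_right h0 hwQ] at this
    norm_num at this
  have h5 := eq_zero_of_wnorm_eq_zero hw0 h4
  linear_combination v * h5 - q * huv

end division

/-! ### Substitution of convergent power series -/

section substitution

variable {n p : ℕ}

/-- Substitution of convergent power series without constant term. -/
def substConv (a : Fin p → convSeries n)
    (ha : ∀ i, constantCoeff (a i : MvPowerSeries (Fin n) ℂ) = 0) :
    convSeries p →ₐ[ℂ] convSeries n :=
  ((substAlgHom (R := ℂ) (hasSubst_of_constantCoeff_zero ha)).comp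
    (convSeries p).val).codRestrict (convSeries n) fun f => by
      rw [AlgHom.comp_apply, substAlgHom_apply]
      exact Convergent.subst (fun i => (a i).2) ha f.2

variable {a : Fin p → convSeries n} {ha : ∀ i, constantCoeff (a i : MvPowerSeries (Fin n) ℂ) = 0}

theorem coe_substConv (f : convSeries p) :
    (substConv a ha f : MvPowerSeries (Fin n) ℂ) =
      subst (fun i => (a i : MvPowerSeries (Fin n) ℂ)) (f : MvPowerSeries (Fin p) ℂ) := by
  simp [substConv]

theorem value_substConv_of_ne_top {z : Fin n → ℂ}
    (haz : ∀ i, ConvergesAt (a i : MvPowerSeries (Fin n) ℂ) z) {f : convSeries p}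
    (hf : wnorm (fun i => wnorm (fun j => ‖z j‖ₑ) (a i : MvPowerSeries (Fin n) ℂ))
      (f : MvPowerSeries (Fin p) ℂ) ≠ ⊤) :
    value (substConv a ha f) z = value f fun i => value (a i) z := by
  rw [value_eq_sumAt, coe_substConv, sumAt_subst (hasSubst_of_constantCoeff_zero ha) haz hf]
  rfl

theorem eventually_enorm_le {w : Fin n → ℝ≥0∞} (hw : ∀ i, w i ≠ 0) :
    ∀ᶠ z in 𝓝 (0 : Fin n → ℂ), ∀ i, ‖z i‖ₑ ≤ w i := by
  rw [eventually_all]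
  intro i
  have hc : Continuous fun z : Fin n → ℂ => ‖z i‖ₑ := by fun_prop
  refine (hc.continuousAt.eventually_lt continuousAt_const
    (by simpa using pos_iff_ne_zero.2 (hw i))).mono fun z hz => hz.le

theorem eventually_value_substConv (f : convSeries p) :
    ∀ᶠ z in 𝓝 (0 : Fin n → ℂ), value (substConv a ha f) z = value f fun i => value (a i) z := by
  obtain ⟨v, hv, hfv⟩ := convergent_iff.1 f.2
  choose w hw hwa using fun i => exists_wnorm_le (a i).2 (ha i) (hv i)
  have h1 : ∀ᶠ z in 𝓝 (0 : Fin n → ℂ), ∀ i, ∀ j, ‖z j‖ₑ ≤ w i j := by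
    rw [eventually_all]
    exact fun i => eventually_enorm_le (hw i)
  have h2 := eventually_all.2 fun i => eventually_convergesAt (a i)
  filter_upwards [h1, h2] with z hz hz2
  refine value_substConv_of_ne_top hz2 (ne_top_of_le_ne_top hfv (wnorm_mono (fun i => ?_) _))
  exact (wnorm_mono (hz i) _).trans (hwa i)

/-- The coordinate `xᵢ`. -/
def coord (i : Fin n) : convSeries n := ⟨X i, convergent_X i⟩

@[simp] theorem coe_coord (i : Fin n) : (coord i : MvPowerSeries (Fin n) ℂ) = X i := rfl

theorem value_coord (i : Fin n) (z : Fin n → ℂ) : value (coord i) z = z i := sumAt_X i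

theorem eventually_value_sum {ι : Type*} (s : Finset ι) (f : ι → convSeries n) :
    ∀ᶠ z in 𝓝 (0 : Fin n → ℂ), value (∑ i ∈ s, f i) z = ∑ i ∈ s, value (f i) z := by
  classical
  induction s using Finset.induction_on with
  | empty => simp [value_zero_left]
  | insert b s hb ih =>
    rw [Finset.sum_insert hb]
    filter_upwards [ih, eventually_value_add (f b) (∑ i ∈ s, f i)] with z h1 h2
    rw [h2, h1, Finset.sum_insert hb]

theorem eventually_value_pow (f : convSeries n) (k : ℕ) :
    ∀ᶠ z in 𝓝 (0 : Fin n → ℂ), value (f ^ k) z = value f z ^ k := by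
  filter_upwards [eventually_convergesAt f] with z hz
  exact sumAt_pow hz k

end substitution

/-! ### Polynomials in `x₀` -/

section polynomials

variable {n : ℕ}

/-- The inclusion of the convergent power series in `x₁, …, xₙ` in those in `x₀, …, xₙ`. -/
def lift : convSeries n →ₐ[ℂ] convSeries (n + 1) :=
  substConv (fun i => coord i.succ) fun i => by simp

theorem coeff_lift (a : convSeries n) (k : ℕ) (x : Fin n →₀ ℕ) :
    coeff (Finsupp.cons k x) (lift a : MvPowerSeries (Fin (n + 1)) ℂ) =
      if k = 0 then coeff x (a : MvPowerSeries (Fin n) ℂ) else 0 := by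
  have h1 : (lift a : MvPowerSeries (Fin (n + 1)) ℂ) =
      rename (Fin.succEmb n) (a : MvPowerSeries (Fin n) ℂ) := by
    rw [rename_eq_subst, lift, coe_substConv]
    rfl
  rw [h1]
  split_ifs with hk
  · have : Finsupp.cons k x = x.embDomain (Fin.succEmb n) := by
      ext i
      refine Fin.cases ?_ (fun j => ?_) i
      · rw [Finsupp.cons_zero, Finsupp.embDomain_of_notMem_range, hk]
        rintro ⟨j, hj⟩
        exact Fin.succ_ne_zero j hj
      · rw [Finsupp.cons_succ]
        exact (Finsupp.embDomain_apply_self (Fin.succEmb n) x j).symm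
    rw [this, coeff_embDomain_rename]
  · refine coeff_rename_eq_zero _ _ ?_
    rintro ⟨y, hy⟩
    refine hk ?_
    have := DFunLike.congr_fun hy 0
    rw [Finsupp.cons_zero, Finsupp.mapDomain_of_notMem_range] at this
    · exact this.symm
    · rintro ⟨j, hj⟩
      exact Fin.succ_ne_zero j hj

theorem eventually_value_lift (a : convSeries n) :
    ∀ᶠ z in 𝓝 (0 : Fin (n + 1) → ℂ), value (lift a) z = value a (Fin.tail z) := by
  filter_upwards [eventually_value_substConv (ha := fun i => by simp)
    (a := fun i : Fin n => coord i.succ) a] with z hz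
  rw [lift, hz]
  congr 1
  ext i
  exact value_coord _ _

theorem ext_cons {f g : MvPowerSeries (Fin (n + 1)) ℂ}
    (h : ∀ k x, coeff (Finsupp.cons k x) f = coeff (Finsupp.cons k x) g) : f = g := by
  ext m
  rw [← Finsupp.cons_tail m]
  exact h _ _

theorem pd_zero_lift (a : convSeries n) : pd 0 (lift a) = 0 := by
  refine Subtype.ext (ext_cons fun k x => ?_)
  change coeff _ (MvPowerSeries.pderiv ℂ 0 (lift a : MvPowerSeries (Fin (n + 1)) ℂ)) = 0
  have : Finsupp.cons k x + Finsupp.single 0 1 = Finsupp.cons (k + 1) x := by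
    ext i
    refine Fin.cases ?_ (fun j => ?_) i <;> simp
  rw [coeff_pderiv, this, coeff_lift]
  simp

theorem pd_succ_lift (i : Fin n) (a : convSeries n) : pd i.succ (lift a) = lift (pd i a) := by
  refine Subtype.ext (ext_cons fun k x => ?_)
  change coeff _ (MvPowerSeries.pderiv ℂ i.succ (lift a : MvPowerSeries (Fin (n + 1)) ℂ)) = _
  have : Finsupp.cons k x + Finsupp.single i.succ 1 = Finsupp.cons k (x + Finsupp.single i 1) := by
    ext j
    refine Fin.cases ?_ (fun j => ?_) j <;> simp [Finsupp.single_apply]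
  rw [coeff_pderiv, this, coeff_lift, coeff_lift, Finsupp.cons_succ]
  change _ = if k = 0 then coeff x (MvPowerSeries.pderiv ℂ i (a : MvPowerSeries (Fin n) ℂ)) else 0
  rw [coeff_pderiv]
  split_ifs <;> simp

/-- The inclusion of the polynomials in `x₀` with coefficients convergent power series in
`x₁, …, xₙ`. -/
def polyMap : Polynomial (convSeries n) →+* convSeries (n + 1) :=
  Polynomial.eval₂RingHom (lift : convSeries n →ₐ[ℂ] convSeries (n + 1)).toRingHom (coord 0)

theorem polyMap_C (a : convSeries n) : polyMap (Polynomial.C a) = lift a := by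
  simp [polyMap]

theorem polyMap_X : polyMap (Polynomial.X : Polynomial (convSeries n)) = coord 0 := by
  simp [polyMap]

theorem polyMap_monomial (k : ℕ) (a : convSeries n) :
    polyMap (Polynomial.monomial k a) = lift a * coord 0 ^ k := by
  simp [polyMap]

theorem coeff_polyMap (R : Polynomial (convSeries n)) (k : ℕ) (x : Fin n →₀ ℕ) :
    coeff (Finsupp.cons k x) (polyMap R : MvPowerSeries (Fin (n + 1)) ℂ) =
      coeff x (R.coeff k : MvPowerSeries (Fin n) ℂ) := by
  induction R using Polynomial.induction_on' with
  | add p q hp hq =>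
    rw [map_add, Polynomial.coeff_add, AddMemClass.coe_add, AddMemClass.coe_add, map_add, map_add,
      hp, hq]
  | monomial j a =>
    rw [polyMap_monomial, MulMemClass.coe_mul, SubmonoidClass.coe_pow, coe_coord, X_pow_eq,
      Polynomial.coeff_monomial]
    by_cases hjk : j ≤ k
    · obtain ⟨l, rfl⟩ := Nat.exists_eq_add_of_le' hjk
      have : Finsupp.cons (l + j) x = Finsupp.cons l x + Finsupp.single 0 j := by
        ext i
        refine Fin.cases ?_ (fun j => ?_) i <;> simp
      rw [this, coeff_add_mul_monomial, coeff_lift, mul_one]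
      by_cases hl : l = 0 <;> simp [hl]
    · rw [coeff_mul_monomial, if_neg, if_neg (by omega)]
      · simp
      · intro h
        have := h 0
        simp at this
        omega

theorem polyMap_injective : Function.Injective (polyMap (n := n)) := by
  intro P Q h
  refine Polynomial.ext fun k => Subtype.ext (MvPowerSeries.ext fun x => ?_)
  rw [← coeff_polyMap, h, coeff_polyMap]

theorem lift_injective : Function.Injective (lift (n := n)) := by
  intro a b h
  rw [← polyMap_C, ← polyMap_C] at h
  exact Polynomial.C_injective (polyMap_injective h)

theorem pd_zero_polyMap (P : Polynomial (convSeries n)) :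
    pd 0 (polyMap P) = polyMap (Polynomial.derivative P) := by
  induction P using Polynomial.induction_on' with
  | add p q hp hq => simp only [map_add, hp, hq]
  | monomial j a =>
    have hX : pd 0 (coord 0 : convSeries (n + 1)) = 1 :=
      Subtype.ext (MvPowerSeries.pderiv_X_self)
    rw [polyMap_monomial, Polynomial.derivative_monomial, polyMap_monomial, Derivation.leibniz,
      Derivation.leibniz_pow, pd_zero_lift, hX, map_mul, map_natCast]
    simp only [smul_eq_mul, nsmul_eq_mul]
    ring

theorem eventually_value_polyMap (R : Polynomial (convSeries n)) :
    ∀ᶠ z in 𝓝 (0 : Fin (n + 1) → ℂ), value (polyMap R) z =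
      ∑ k ∈ Finset.range (R.natDegree + 1), value (R.coeff k) (Fin.tail z) * z 0 ^ k := by
  have h1 : polyMap R = ∑ k ∈ Finset.range (R.natDegree + 1), lift (R.coeff k) * coord 0 ^ k := by
    conv_lhs => rw [R.as_sum_range]
    simp [polyMap_monomial]
  have h2 : ∀ᶠ z in 𝓝 (0 : Fin (n + 1) → ℂ), ∀ k ∈ Finset.range (R.natDegree + 1),
      value (lift (R.coeff k) * coord 0 ^ k) z = value (R.coeff k) (Fin.tail z) * z 0 ^ k := by
    rw [Finset.eventually_all]
    intro k _
    filter_upwards [eventually_value_lift (R.coeff k), eventually_value_mul (lift (R.coeff k))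
      (coord 0 ^ k), eventually_value_pow (coord (0 : Fin (n + 1))) k] with z h1 h2 h3
    rw [h2, h1, h3, value_coord]
  filter_upwards [eventually_value_sum (Finset.range (R.natDegree + 1))
    fun k => lift (R.coeff k) * coord 0 ^ k, h2] with z h3 h4
  rw [h1, h3]
  exact Finset.sum_congr rfl h4

/-- The coefficient of `x₀ ^ k`. -/
def slice (k : ℕ) (r : MvPowerSeries (Fin (n + 1)) ℂ) : MvPowerSeries (Fin n) ℂ :=
  fun x => coeff (Finsupp.cons k x) r

theorem Convergent.slice {r : MvPowerSeries (Fin (n + 1)) ℂ} (hr : Convergent r) (k : ℕ) :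
    Convergent (slice k r) := by
  obtain ⟨w, hw, h⟩ := convergent_iff.1 hr
  refine convergent_iff.2 ⟨fun i => w i.succ, fun i => hw _, fun htop => h ?_⟩
  have h1 : w 0 ^ k * wnorm (fun i => w i.succ) (ConvSeries.slice k r) ≤ wnorm w r := by
    rw [wnorm, ← ENNReal.tsum_mul_left]
    have : ∀ x : Fin n →₀ ℕ, w 0 ^ k * (‖coeff x (ConvSeries.slice k r)‖ₑ *
        wt (fun i => w i.succ) x) =
        ‖coeff (Finsupp.cons k x) r‖ₑ * wt w (Finsupp.cons k x) := by
      intro x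
      rw [wt, wt, Fin.prod_univ_succ]
      simp only [Finsupp.cons_zero, Finsupp.cons_succ]
      change w 0 ^ k * (‖coeff (Finsupp.cons k x) r‖ₑ * _) = _
      ring
    simp_rw [this]
    exact ENNReal.tsum_comp_le_tsum_of_injective (Finsupp.cons_right_injective k)
      fun m => ‖coeff m r‖ₑ * wt w m
  rw [htop, ENNReal.mul_top (pow_ne_zero _ (hw 0))] at h1
  exact top_le_iff.1 h1

/-- Turns the remainders of Weierstrass division into actual polynomials in x₀. -/
theorem exists_polyMap_eq {r : MvPowerSeries (Fin (n + 1)) ℂ} (hr : Convergent r) {d : ℕ}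
    (hrd : ∀ m, d ≤ m 0 → coeff m r = 0) :
    ∃ R : Polynomial (convSeries n), R.degree < d ∧
      (polyMap R : MvPowerSeries (Fin (n + 1)) ℂ) = r := by
  let R : Polynomial (convSeries n) :=
    ∑ k ∈ Finset.range d, Polynomial.monomial k ⟨slice k r, hr.slice k⟩
  have hR : ∀ k, (R.coeff k : MvPowerSeries (Fin n) ℂ) = slice k r := by
    intro k
    simp only [R, Polynomial.finsetSum_coeff, Polynomial.coeff_monomial, Finset.sum_ite_eq',
      Finset.mem_range]
    split_ifs with hk
    · rfl
    · ext x
      exact (hrd _ (by simpa using hk)).symm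
  refine ⟨R, ?_, ext_cons fun k x => ?_⟩
  · rw [Polynomial.degree_lt_iff_coeff_zero]
    intro k hk
    refine Subtype.ext ((hR k).trans (MvPowerSeries.ext fun x => hrd _ (by simpa using hk)))
  · rw [coeff_polyMap, hR]
    rfl

/-! ### Weierstrass polynomials -/

/-- Monic polynomials whose other coefficients vanish at the origin. -/
def IsWeierstrass (P : Polynomial (convSeries n)) : Prop :=
  P.Monic ∧ ∀ k < P.natDegree, constantCoeff (P.coeff k : MvPowerSeries (Fin n) ℂ) = 0

theorem coeff_single_polyMap (R : Polynomial (convSeries n)) (k : ℕ) :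
    coeff (Finsupp.single 0 k) (polyMap R : MvPowerSeries (Fin (n + 1)) ℂ) =
      constantCoeff (R.coeff k : MvPowerSeries (Fin n) ℂ) := by
  rw [← Finsupp.cons_zero_eq_single_zero, coeff_polyMap]
  rfl

theorem IsWeierstrass.isRegular {P : Polynomial (convSeries n)} (hP : IsWeierstrass P) :
    IsRegular (polyMap P : MvPowerSeries (Fin (n + 1)) ℂ) P.natDegree := by
  refine ⟨fun k hk => ?_, ?_⟩
  · rw [coeff_single_polyMap, hP.2 k hk]
  · rw [coeff_single_polyMap, hP.1.coeff_natDegree]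
    simp

theorem IsWeierstrass.exists_div {P : Polynomial (convSeries n)} (hP : IsWeierstrass P)
    (f : convSeries (n + 1)) : ∃ (q : convSeries (n + 1)) (R : Polynomial (convSeries n)),
      f = q * polyMap P + polyMap R ∧ R.degree < P.degree := by
  obtain ⟨q, r, hq, hr, hfr, hrd⟩ := hP.isRegular.exists_div (polyMap P).2 f.2
  obtain ⟨R, hR, rfl⟩ := exists_polyMap_eq hr hrd
  refine ⟨⟨q, hq⟩, R, Subtype.ext hfr, ?_⟩
  rwa [Polynomial.degree_eq_natDegree hP.1.ne_zero]

/-- Uniqueness of Weierstrass division: R = q P + 0 and R = 0 P + R are two divisions of the same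
series. -/
theorem IsWeierstrass.eq_zero_of_dvd {P R : Polynomial (convSeries n)} (hP : IsWeierstrass P)
    (hR : R.degree < P.degree) (h : polyMap P ∣ polyMap R) : R = 0 := by
  obtain ⟨q, hq⟩ := h
  have hq0 : (q : MvPowerSeries (Fin (n + 1)) ℂ) = 0 := by
    refine hP.isRegular.eq_zero_of_mul_eq (polyMap P).2 q.2
      (r := (polyMap R : MvPowerSeries (Fin (n + 1)) ℂ)) ?_ fun m hm => ?_
    · rw [hq, mul_comm]; rfl
    · rw [← Finsupp.cons_tail m, coeff_polyMap, Polynomial.coeff_eq_zero_of_degree_lt]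
      · simp
      · refine hR.trans_le ?_
        rw [Polynomial.degree_eq_natDegree hP.1.ne_zero]
        exact_mod_cast hm
  have hq1 : q = 0 := Subtype.ext hq0
  rw [hq1, mul_zero] at hq
  exact polyMap_injective (by rw [hq, map_zero])

/-- The Euclidean remainder by the monic P is also the Weierstrass remainder, so both divisibilities
say that it vanishes. -/
theorem IsWeierstrass.dvd_iff {P : Polynomial (convSeries n)} (hP : IsWeierstrass P)
    (R : Polynomial (convSeries n)) : polyMap P ∣ polyMap R ↔ P ∣ R := by
  refine ⟨fun h => ?_, fun h => map_dvd polyMap h⟩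
  rw [← Polynomial.modByMonic_eq_zero_iff_dvd hP.1]
  refine hP.eq_zero_of_dvd (Polynomial.degree_modByMonic_lt _ hP.1) ?_
  have h1 := Polynomial.modByMonic_add_div R P
  rw [← h1, map_add, map_mul] at h
  exact (dvd_add_left (dvd_mul_right _ _)).1 h

/-- The Weierstrass preparation theorem. -/
theorem IsRegular.exists_isWeierstrass {h : convSeries (n + 1)} {d : ℕ}
    (hr : IsRegular (h : MvPowerSeries (Fin (n + 1)) ℂ) d) :
    ∃ P : Polynomial (convSeries n), IsWeierstrass P ∧ Associated h (polyMap P) := by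
  have hX : Convergent ((X 0 : MvPowerSeries (Fin (n + 1)) ℂ) ^ d) :=
    (convSeries (n + 1)).pow_mem (convergent_X 0) d
  -- Dividing x₀^d by h gives q h = x₀^d − R. Comparing coefficients on the x₀-axis shows that q is
  -- a unit and that x₀^d − R is a Weierstrass polynomial.
  obtain ⟨q, r, hq, hrc, hqr, hrd⟩ := hr.exists_div h.2 hX
  obtain ⟨R, hR, rfl⟩ := exists_polyMap_eq hrc hrd
  -- On the x₀-axis h starts in degree d, so up to that degree only the constant term of q
  -- contributes.
  have hlow : ∀ k ≤ d, coeff (Finsupp.single 0 k) (q * (h : MvPowerSeries (Fin (n + 1)) ℂ)) =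
      constantCoeff q * coeff (Finsupp.single 0 k) (h : MvPowerSeries (Fin (n + 1)) ℂ) := by
    intro k hk
    rw [coeff_mul]
    refine (Finset.sum_eq_single (0, Finsupp.single 0 k) (fun p hp hne => ?_) (by simp)).trans rfl
    have hp' := Finset.HasAntidiagonal.mem_antidiagonal.1 hp
    have hp2 : p.2 = Finsupp.single 0 (p.2 0) := by
      ext i
      by_cases hi : i = 0
      · simp [hi]
      · have := DFunLike.congr_fun hp' i
        simp [Ne.symm hi] at this
        simp [this.2, Ne.symm hi]
    have h0 : p.1 0 + p.2 0 = k := by simpa using DFunLike.congr_fun hp' 0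
    rcases eq_or_ne (p.2 0) k with hk' | hk'
    · exfalso
      apply hne
      rw [hk'] at hp2
      rw [hp2] at hp'
      exact Prod.ext (by simpa using hp') hp2
    · rw [hp2, hr.1 _ (by omega), mul_zero]
  have hcoef : ∀ k ≤ d, (if k = d then 1 else 0 : ℂ) = constantCoeff q *
      coeff (Finsupp.single 0 k) (h : MvPowerSeries (Fin (n + 1)) ℂ) +
        constantCoeff (R.coeff k : MvPowerSeries (Fin n) ℂ) := by
    intro k hk
    rw [← hlow k hk, ← coeff_single_polyMap, ← map_add, ← hqr, coeff_X_pow]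
    simp only [(Finsupp.single_injective (0 : Fin (n + 1))).eq_iff]
  have hRd : R.coeff d = 0 := Polynomial.coeff_eq_zero_of_degree_lt hR
  have hq0 : constantCoeff q ≠ 0 := by
    intro h0
    have := hcoef d le_rfl
    simp [h0, hRd] at this
  have hR0 : ∀ k < d, constantCoeff (R.coeff k : MvPowerSeries (Fin n) ℂ) = 0 := by
    intro k hk
    have := hcoef k hk.le
    rw [if_neg hk.ne, hr.1 k hk, mul_zero, zero_add] at this
    exact this.symm
  have hmon : (Polynomial.X ^ d - R).Monic := Polynomial.monic_X_pow_sub hR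
  have hdeg : (Polynomial.X ^ d - R).natDegree = d := by
    refine Polynomial.natDegree_eq_of_degree_eq_some ?_
    rw [Polynomial.degree_sub_eq_left_of_degree_lt (by rwa [Polynomial.degree_X_pow]),
      Polynomial.degree_X_pow]
  refine ⟨Polynomial.X ^ d - R, ⟨hmon, fun k hk => ?_⟩, ?_⟩
  · rw [hdeg] at hk
    rw [Polynomial.coeff_sub, Polynomial.coeff_X_pow, if_neg hk.ne, zero_sub, NegMemClass.coe_neg,
      map_neg, hR0 k hk, neg_zero]
  · obtain ⟨q', rfl⟩ : ∃ q' : convSeries (n + 1), (q' : MvPowerSeries (Fin (n + 1)) ℂ) = q :=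
      ⟨⟨q, hq⟩, rfl⟩
    have hqu : IsUnit q' := (isUnit_iff _).2 hq0
    refine ⟨hqu.unit, ?_⟩
    have hqr' : coord 0 ^ d = q' * h + polyMap R := Subtype.ext hqr
    have hsub : polyMap (Polynomial.X ^ d - R) = polyMap (Polynomial.X ^ d) - polyMap R :=
      map_sub polyMap _ _
    rw [hsub, map_pow, polyMap_X, hqr', IsUnit.unit_spec]
    ring

end polynomials

/-! ### Linear changes of coordinates -/

open WithPiTopology in
theorem continuous_pderiv {R σ : Type*} [CommRing R] [TopologicalSpace R] [IsTopologicalRing R]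
    (i : σ) : Continuous (MvPowerSeries.pderiv R i) := by
  refine continuous_pi fun d => ?_
  change Continuous fun f => coeff d (MvPowerSeries.pderiv R i f)
  simp_rw [coeff_pderiv]
  exact (continuous_coeff R _).mul continuous_const

open WithPiTopology in
/-- The chain rule for formal power series. -/
theorem pderiv_subst {R σ τ : Type*} [CommRing R] [Fintype σ] {a : σ → MvPowerSeries τ R}
    (ha : HasSubst a) (k : τ) (f : MvPowerSeries σ R) :
    MvPowerSeries.pderiv R k (subst a f) =
      ∑ j, subst a (MvPowerSeries.pderiv R j f) * MvPowerSeries.pderiv R k (a j) := by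
  classical
  -- For the discrete topology on R both sides are continuous in f, so it suffices to compare them
  -- on the dense subring of polynomials.
  let _ : UniformSpace R := ⊥
  have _ : DiscreteUniformity R := ⟨rfl⟩
  have hs := continuous_subst (R := R) ha
  have h1 : Continuous fun f : MvPowerSeries σ R => MvPowerSeries.pderiv R k (subst a f) :=
    (continuous_pderiv k).comp hs
  have h2 : Continuous fun f : MvPowerSeries σ R =>
      ∑ j, subst a (MvPowerSeries.pderiv R j f) * MvPowerSeries.pderiv R k (a j) :=
    continuous_finsetSum _ fun j _ => (hs.comp (continuous_pderiv j)).mul continuous_const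
  refine congrFun (denseRange_toMvPowerSeries.equalizer h1 h2 (funext fun p => ?_)) f
  simp only [Function.comp]
  rw [← coe_substAlgHom ha]
  change MvPowerSeries.pderiv R k (substAlgHom ha (p : MvPowerSeries σ R)) =
    ∑ j, substAlgHom ha (MvPowerSeries.pderiv R j (p : MvPowerSeries σ R)) *
      MvPowerSeries.pderiv R k (a j)
  have hX : ∀ i, substAlgHom (R := R) ha (X i) = a i := substAlgHom_X ha
  generalize substAlgHom (R := R) ha = φ at hX ⊢
  induction p using MvPolynomial.induction_on with
  | C c =>
    have h3 : φ (MvPowerSeries.C c : MvPowerSeries σ R) = MvPowerSeries.C c := φ.commutes c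
    rw [MvPolynomial.coe_C, h3]
    simp
  | add p q hp hq =>
    simp only [MvPolynomial.coe_add, map_add, hp, hq, add_mul, Finset.sum_add_distrib]
  | mul_X p i hp =>
    simp only [MvPolynomial.coe_mul, MvPolynomial.coe_X, map_mul, Derivation.leibniz, hp,
      smul_eq_mul, map_add, add_mul, Finset.sum_add_distrib, hX, MvPowerSeries.pderiv_X,
      Finset.mul_sum]
    congr 1
    · rw [Finset.sum_eq_single i]
      · simp
      · intro j _ hj
        simp [hj.symm]
      · simp
    · exact Finset.sum_congr rfl fun j _ => by ring

section linear

variable {n : ℕ}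

instance : IsDomain (MvPowerSeries (Fin n) ℂ) := NoZeroDivisors.to_isDomain _

instance : IsDomain (convSeries n) := inferInstance

/-- The linear form with coefficients the `i`-th row of `M`. -/
def linForm (M : Matrix (Fin n) (Fin n) ℂ) (i : Fin n) : convSeries n := ∑ j, M i j • coord j

theorem coe_linForm (M : Matrix (Fin n) (Fin n) ℂ) (i : Fin n) :
    (linForm M i : MvPowerSeries (Fin n) ℂ) = ∑ j, C (M i j) * X j := by
  simp [linForm, smul_eq_C_mul]

theorem constantCoeff_linForm (M : Matrix (Fin n) (Fin n) ℂ) (i : Fin n) :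
    constantCoeff (linForm M i : MvPowerSeries (Fin n) ℂ) = 0 := by
  rw [coe_linForm]
  simp

/-- Precomposition with the linear map with matrix `M`. -/
def linChange (M : Matrix (Fin n) (Fin n) ℂ) : convSeries n →ₐ[ℂ] convSeries n :=
  substConv (linForm M) (constantCoeff_linForm M)

theorem coe_linChange (M : Matrix (Fin n) (Fin n) ℂ) (f : convSeries n) :
    (linChange M f : MvPowerSeries (Fin n) ℂ) =
      subst (fun i => (linForm M i : MvPowerSeries (Fin n) ℂ)) (f : MvPowerSeries (Fin n) ℂ) :=
  coe_substConv f

theorem hasSubst_linForm (M : Matrix (Fin n) (Fin n) ℂ) :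
    HasSubst fun i => (linForm M i : MvPowerSeries (Fin n) ℂ) :=
  hasSubst_of_constantCoeff_zero (constantCoeff_linForm M)

theorem linChange_coord (M : Matrix (Fin n) (Fin n) ℂ) (i : Fin n) :
    linChange M (coord i) = linForm M i :=
  Subtype.ext (by rw [coe_linChange, coe_coord, subst_X (hasSubst_linForm M)])

theorem linChange_linChange (M N : Matrix (Fin n) (Fin n) ℂ) (f : convSeries n) :
    linChange N (linChange M f) = linChange (M * N) f := by
  refine Subtype.ext ?_
  rw [coe_linChange, coe_linChange, coe_linChange,
    subst_comp_subst_apply (hasSubst_linForm M) (hasSubst_linForm N)]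
  congr 1
  funext i
  rw [← coe_linChange]
  congr 1
  have : linForm M i = ∑ j, M i j • coord j := rfl
  rw [this, map_sum]
  simp only [map_smul, linChange_coord, linForm, Finset.smul_sum, smul_smul, Matrix.mul_apply,
    Finset.sum_smul]
  exact Finset.sum_comm

theorem linChange_one (f : convSeries n) : linChange 1 f = f := by
  refine Subtype.ext ?_
  rw [coe_linChange]
  have : (fun i => (linForm 1 i : MvPowerSeries (Fin n) ℂ)) = X := by
    funext i
    rw [coe_linForm, Finset.sum_eq_single i]
    · simp
    · intro j _ hj
      simp [hj.symm]
    · simp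
  rw [this, subst_self]
  rfl

/-- Precomposition with an invertible linear map. -/
def linEquiv (M N : Matrix (Fin n) (Fin n) ℂ) (h : M * N = 1) (h' : N * M = 1) :
    convSeries n ≃ₐ[ℂ] convSeries n :=
  AlgEquiv.ofAlgHom (linChange M) (linChange N)
    (AlgHom.ext fun f => by
      rw [AlgHom.comp_apply, linChange_linChange, h', linChange_one]; rfl)
    (AlgHom.ext fun f => by
      rw [AlgHom.comp_apply, linChange_linChange, h, linChange_one]; rfl)

theorem wnorm_linForm_le (M : Matrix (Fin n) (Fin n) ℂ) (w : Fin n → ℝ≥0∞) (i : Fin n) :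
    wnorm w (linForm M i : MvPowerSeries (Fin n) ℂ) ≤ ∑ j, ‖M i j‖ₑ * w j := by
  rw [coe_linForm]
  refine (wnorm_sum_le _ _ _).trans (Finset.sum_le_sum fun j _ => ?_)
  refine (wnorm_mul_le _ _ _).trans ?_
  rw [wnorm_C, wnorm_X]

theorem convergesAt_linForm (M : Matrix (Fin n) (Fin n) ℂ) (i : Fin n) (z : Fin n → ℂ) :
    ConvergesAt (linForm M i : MvPowerSeries (Fin n) ℂ) z :=
  ne_top_of_le_ne_top (by simp [ENNReal.sum_eq_top, ENNReal.mul_eq_top])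
    (wnorm_linForm_le M _ i)

theorem value_linForm (M : Matrix (Fin n) (Fin n) ℂ) (i : Fin n) (z : Fin n → ℂ) :
    value (linForm M i) z = M.mulVec z i := by
  have key : ∀ s : Finset (Fin n),
      ConvergesAt (∑ j ∈ s, C (M i j) * X j : MvPowerSeries (Fin n) ℂ) z ∧
      sumAt (∑ j ∈ s, C (M i j) * X j : MvPowerSeries (Fin n) ℂ) z = ∑ j ∈ s, M i j * z j := by
    intro s
    induction s using Finset.induction_on with
    | empty =>
      have h0 : (0 : MvPowerSeries (Fin n) ℂ) = C 0 := (map_zero C).symm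
      simp only [Finset.sum_empty]
      rw [h0]
      exact ⟨convergesAt_C 0, sumAt_C 0⟩
    | insert b s hb ih =>
      have h1 : ConvergesAt (C (M i b) * X b : MvPowerSeries (Fin n) ℂ) z :=
        (convergesAt_C _).mul (convergesAt_X b)
      rw [Finset.sum_insert hb, Finset.sum_insert hb, sumAt_add h1 ih.1, ih.2,
        sumAt_mul (convergesAt_C _) (convergesAt_X b), sumAt_C, sumAt_X]
      exact ⟨h1.add ih.1, rfl⟩
  rw [value_eq_sumAt, coe_linForm, (key _).2]
  rfl

theorem eventually_value_linChange (M : Matrix (Fin n) (Fin n) ℂ) (f : convSeries n) :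
    ∀ᶠ z in 𝓝 (0 : Fin n → ℂ), value (linChange M f) z = value f (M.mulVec z) := by
  filter_upwards [eventually_value_substConv (ha := constantCoeff_linForm M) f] with z hz
  rw [linChange, hz]
  congr 1
  funext i
  exact value_linForm M i z

theorem pd_linChange (M : Matrix (Fin n) (Fin n) ℂ) (k : Fin n) (f : convSeries n) :
    pd k (linChange M f) = ∑ j, M j k • linChange M (pd j f) := by
  refine Subtype.ext ?_
  change MvPowerSeries.pderiv ℂ k (linChange M f : MvPowerSeries (Fin n) ℂ) = _
  rw [coe_linChange, pderiv_subst (hasSubst_linForm M), AddSubmonoidClass.coe_finsetSum]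
  refine Finset.sum_congr rfl fun j _ => ?_
  have h1 : MvPowerSeries.pderiv ℂ k (linForm M j : MvPowerSeries (Fin n) ℂ) = C (M j k) := by
    rw [coe_linForm, map_sum, Finset.sum_eq_single k]
    · simp [Derivation.leibniz, pderiv_X_self]
    · intro l _ hl
      simp [Derivation.leibniz, pderiv_X_of_ne hl]
    · simp
  have h2 : ((M j k • linChange M (pd j f) : convSeries n) : MvPowerSeries (Fin n) ℂ) =
      M j k • (linChange M (pd j f) : MvPowerSeries (Fin n) ℂ) := rfl
  rw [h1, h2, coe_linChange, smul_eq_C_mul, mul_comm]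
  rfl

/-- Each term of the sum is zero, so convergence at this point, which need not be near 0, plays no
role. -/
theorem value_single_eq_zero {f : convSeries (n + 1)}
    (hf : ∀ k, coeff (Finsupp.single 0 k) (f : MvPowerSeries (Fin (n + 1)) ℂ) = 0) :
    value f (Pi.single 0 1) = 0 := by
  have h0 : ∀ m : Fin (n + 1) →₀ ℕ, coeff m (f : MvPowerSeries (Fin (n + 1)) ℂ) *
      m.prod ((Pi.single 0 1 : Fin (n + 1) → ℂ) · ^ ·) = 0 := by
    intro m
    by_cases hm : ∀ i, i ≠ 0 → m i = 0
    · have : m = Finsupp.single 0 (m 0) := by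
        ext i
        by_cases hi : i = 0
        · simp [hi]
        · simp [hm i hi, Ne.symm hi]
      rw [this, hf, zero_mul]
    · push Not at hm
      obtain ⟨i, hi, hmi⟩ := hm
      rw [Finsupp.prod_fintype _ _ (by simp), Finset.prod_eq_zero (Finset.mem_univ i), mul_zero]
      simp [hi, hmi]
  rw [value]
  simp only [h0, tsum_zero]

/-- After a linear change of coordinates, a convergent power series is regular in `x₀`. -/
theorem exists_linEquiv_isRegular {h : convSeries (n + 1)} (h0 : h ≠ 0) (hu : ¬ IsUnit h) :
    ∃ (σ : convSeries (n + 1) ≃ₐ[ℂ] convSeries (n + 1))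
      (A : (Fin (n + 1) → ℂ) ≃L[ℂ] (Fin (n + 1) → ℂ)),
      (∀ f, ∀ᶠ z in 𝓝 (0 : Fin (n + 1) → ℂ), value (σ f) z = value f (A z)) ∧
      (∀ k, ∃ c : Fin (n + 1) → ℂ, ∀ f, pd k (σ f) = ∑ j, c j • σ (pd j f)) ∧
      ∃ d, IsRegular (σ h : MvPowerSeries (Fin (n + 1)) ℂ) d := by
  obtain ⟨v, hv, hfv⟩ := convergent_iff.1 h.2
  -- The identity theorem provides b in the polydisc of convergence with h(b) ≠ 0, and b ≠ 0 because
  -- h is not a unit. A linear map A sending e₀ to b makes h ∘ A nonzero on the x₀-axis.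
  have hfreq : ∃ᶠ z in 𝓝 (0 : Fin (n + 1) → ℂ), value h z ≠ 0 := by
    intro hev
    exact h0 (eq_zero_of_eventually_value_eq_zero (hev.mono fun z hz => not_not.1 hz))
  obtain ⟨b, hb, hbv⟩ := (hfreq.and_eventually (eventually_enorm_le hv)).exists
  have hb0 : b ≠ 0 := by
    rintro rfl
    rw [value_at_zero] at hb
    exact hu ((isUnit_iff h).2 hb)
  obtain ⟨A, hA⟩ := SeparatingDual.exists_continuousLinearEquiv_apply_eq (R := ℂ)
    (x := (Pi.single 0 1 : Fin (n + 1) → ℂ)) (by simp) hb0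
  let M : Matrix (Fin (n + 1)) (Fin (n + 1)) ℂ := LinearMap.toMatrix' A.toLinearEquiv.toLinearMap
  let N : Matrix (Fin (n + 1)) (Fin (n + 1)) ℂ :=
    LinearMap.toMatrix' A.toLinearEquiv.symm.toLinearMap
  have hMN : M * N = 1 := by
    rw [← LinearMap.toMatrix'_comp]
    simp
  have hNM : N * M = 1 := by
    rw [← LinearMap.toMatrix'_comp]
    simp
  have hMA : ∀ z, M.mulVec z = A z := fun z => by
    simp [M, LinearMap.toMatrix'_mulVec]
  have hMb : M.mulVec (Pi.single 0 1) = b := by rw [hMA, hA]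
  refine ⟨linEquiv M N hMN hNM, A, fun f => ?_, fun k => ⟨fun j => M j k, pd_linChange M k⟩, ?_⟩
  · filter_upwards [eventually_value_linChange M f] with z hz
    rw [← hMA]
    exact hz
  -- The point e₀ is not near 0, but the substitution formula holds there because b lies in the
  -- polydisc of convergence of h.
  · have hval : value (linChange M h) (Pi.single 0 1) = value h b := by
      rw [linChange, value_substConv_of_ne_top fun i => convergesAt_linForm M i _]
      · congr 1
        rw [← hMb]
        funext i
        exact value_linForm M i _
      · refine ne_top_of_le_ne_top hfv (wnorm_mono (fun i => ?_) _)
        refine (wnorm_linForm_le M _ i).trans (le_trans (le_of_eq ?_) (hbv i))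
        rw [← hMb, Finset.sum_eq_single 0]
        · simp
        · intro j _ hj
          simp [hj]
        · simp
    have hex : ∃ k, coeff (Finsupp.single 0 k)
        (linChange M h : MvPowerSeries (Fin (n + 1)) ℂ) ≠ 0 := by
      by_contra! hcon
      rw [value_single_eq_zero hcon] at hval
      exact hb hval.symm
    classical
    exact ⟨Nat.find hex, fun k hk => not_not.1 (Nat.find_min hex hk), Nat.find_spec hex⟩

end linear

/-! ### Unique factorization -/

/-- The hypotheses say that A[X]/(P) → B/(φ P) is surjective (`hdiv`) and injective (`hdvd`), so
B/(φ P) is a domain too. -/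
theorem prime_map_of_division {A B : Type*} [CommRing A] [CommRing B]
    (φ : Polynomial A →+* B) {P : Polynomial A} (hP : Prime P) (h0 : φ P ≠ 0)
    (hdiv : ∀ f, ∃ q R, f = q * φ P + φ R) (hdvd : ∀ R, φ P ∣ φ R → P ∣ R) : Prime (φ P) := by
  refine ⟨h0, fun hu => hP.not_isUnit ?_, fun a b hab => ?_⟩
  · exact isUnit_of_dvd_one (hdvd 1 (by rw [map_one]; exact hu.dvd))
  · obtain ⟨q₁, R₁, rfl⟩ := hdiv a
    obtain ⟨q₂, R₂, rfl⟩ := hdiv b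
    have h1 : φ P ∣ φ (R₁ * R₂) := by
      have : (q₁ * φ P + φ R₁) * (q₂ * φ P + φ R₂) =
          φ P * (q₁ * (q₂ * φ P + φ R₂) + q₂ * φ R₁) + φ (R₁ * R₂) := by
        rw [map_mul]; ring
      rw [this] at hab
      exact (dvd_add_right (dvd_mul_right _ _)).1 hab
    rcases hP.dvd_or_dvd (hdvd _ h1) with h | h
    · exact Or.inl (dvd_add (dvd_mul_left _ _) (map_dvd φ h))
    · exact Or.inr (dvd_add (dvd_mul_left _ _) (map_dvd φ h))

section factorization

variable {n : ℕ}

/-- The value at the origin, as a ring homomorphism. -/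
def evalZero : convSeries n →+* ℂ :=
  (constantCoeff (σ := Fin n) (R := ℂ)).comp (convSeries n).val.toRingHom

theorem evalZero_apply (f : convSeries n) :
    evalZero f = constantCoeff (f : MvPowerSeries (Fin n) ℂ) := rfl

theorem IsWeierstrass.map_evalZero {P : Polynomial (convSeries n)} (hP : IsWeierstrass P) :
    P.map evalZero = Polynomial.X ^ P.natDegree := by
  ext k
  rw [Polynomial.coeff_map, Polynomial.coeff_X_pow]
  split_ifs with hk
  · rw [hk, hP.1.coeff_natDegree, map_one]
  · rcases lt_or_gt_of_ne hk with h | h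
    · exact hP.2 k h
    · rw [Polynomial.coeff_eq_zero_of_natDegree_lt h, map_zero]

/-- Evaluating coefficients at the origin turns P into X^d, whose divisors are powers of X up to
units. A unit has nonzero constant term there, so f has degree 0. -/
theorem IsWeierstrass.eq_one_of_isUnit {P f g : Polynomial (convSeries n)} (hP : IsWeierstrass P)
    (hf : f.Monic) (hfg : f * g = P) (hu : IsUnit (polyMap f)) : f = 1 := by
  have h0 : evalZero (f.coeff 0) ≠ 0 := by
    rw [evalZero_apply, ← coeff_single_polyMap, Finsupp.single_zero]
    exact (isUnit_iff _).1 hu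
  have h1 : f.map evalZero ∣ Polynomial.X ^ P.natDegree := by
    rw [← hP.map_evalZero, ← hfg, Polynomial.map_mul]
    exact dvd_mul_right _ _
  obtain ⟨i, -, hi⟩ := (dvd_prime_pow Polynomial.prime_X _).1 h1
  have hi0 : i = 0 := by
    by_contra hne
    have h2 : Polynomial.X ∣ f.map evalZero := (dvd_pow_self _ hne).trans hi.symm.dvd
    rw [Polynomial.X_dvd_iff, Polynomial.coeff_map] at h2
    exact h0 h2
  rw [hi0, pow_zero, associated_one_iff_isUnit] at hi
  have h3 : f.natDegree = 0 := by
    rw [← hf.natDegree_map (evalZero (n := n))]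
    exact Polynomial.natDegree_eq_zero_of_isUnit hi
  exact hf.natDegree_eq_zero.1 h3

theorem IsWeierstrass.irreducible {P : Polynomial (convSeries n)} (hP : IsWeierstrass P)
    (h : Irreducible (polyMap P)) : Irreducible P := by
  have h1 : P ≠ 1 := by
    rintro rfl
    exact h.not_isUnit (by rw [map_one]; exact isUnit_one)
  rw [hP.1.irreducible_iff_natDegree]
  refine ⟨h1, fun f g hf hg hfg => ?_⟩
  have h2 : polyMap P = polyMap f * polyMap g := by rw [← hfg, map_mul]
  rcases h.isUnit_or_isUnit h2 with hu | hu
  · left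
    rw [hP.eq_one_of_isUnit hf hfg hu, Polynomial.natDegree_one]
  · right
    rw [hP.eq_one_of_isUnit hg ((mul_comm g f).trans hfg) hu, Polynomial.natDegree_one]

/-- By Gauss's lemma P is prime in the polynomial ring, and Weierstrass division carries primality
over to the power series. -/
theorem IsWeierstrass.prime [UniqueFactorizationMonoid (convSeries n)]
    {P : Polynomial (convSeries n)} (hP : IsWeierstrass P) (h : Irreducible P) :
    Prime (polyMap P) := by
  refine prime_map_of_division polyMap (UniqueFactorizationMonoid.irreducible_iff_prime.1 h)
    (fun h0 => h.ne_zero (polyMap_injective (h0.trans (map_zero _).symm))) (fun f => ?_)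
    fun R => (hP.dvd_iff R).1
  obtain ⟨q, R, hf, -⟩ := hP.exists_div f
  exact ⟨q, R, hf⟩

/-- An irreducible convergent power series is, up to a linear change of coordinates and a unit, an
irreducible Weierstrass polynomial. -/
theorem exists_isWeierstrass {h : convSeries (n + 1)} (hh : Irreducible h) :
    ∃ (σ : convSeries (n + 1) ≃ₐ[ℂ] convSeries (n + 1))
      (A : (Fin (n + 1) → ℂ) ≃L[ℂ] (Fin (n + 1) → ℂ)) (P : Polynomial (convSeries n)),
      (∀ f, ∀ᶠ z in 𝓝 (0 : Fin (n + 1) → ℂ), value (σ f) z = value f (A z)) ∧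
      (∀ k, ∃ c : Fin (n + 1) → ℂ, ∀ f, pd k (σ f) = ∑ j, c j • σ (pd j f)) ∧
      IsWeierstrass P ∧ Associated (σ h) (polyMap P) ∧ Irreducible P := by
  obtain ⟨σ, A, h1, h2, d, hd⟩ := exists_linEquiv_isRegular hh.ne_zero hh.not_isUnit
  obtain ⟨P, hP, hPh⟩ := hd.exists_isWeierstrass
  refine ⟨σ, A, P, h1, h2, hP, hPh, hP.irreducible ?_⟩
  rw [← hPh.irreducible_iff]
  exact (MulEquiv.irreducible_iff σ).2 hh

/-- The order is additive and nonunits have positive order; this gives termination of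
factorizations. -/
theorem order_lt_order_of_dvdNotUnit {a b : convSeries n} (h : DvdNotUnit a b) :
    (a : MvPowerSeries (Fin n) ℂ).order < (b : MvPowerSeries (Fin n) ℂ).order := by
  obtain ⟨ha, x, hx, rfl⟩ := h
  have ha' : (a : MvPowerSeries (Fin n) ℂ).order ≠ ⊤ := by
    rw [ne_eq, order_eq_top_iff]
    exact fun h0 => ha (Subtype.ext h0)
  have hx' : (x : MvPowerSeries (Fin n) ℂ).order ≠ 0 := by
    rw [order_ne_zero_iff_constCoeff_eq_zero]
    by_contra h0
    exact hx ((isUnit_iff x).2 h0)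
  rw [MulMemClass.coe_mul, order_mul]
  simpa using (ENat.add_lt_add_iff_left ha').2 (pos_iff_ne_zero.2 hx')

instance : WfDvdMonoid (convSeries n) :=
  ⟨Subrelation.wf (r := InvImage (· < ·) fun a : convSeries n =>
    (a : MvPowerSeries (Fin n) ℂ).order) order_lt_order_of_dvdNotUnit (InvImage.wf _ wellFounded_lt)⟩

theorem uniqueFactorizationMonoid_of_prime
    (h : ∀ a : convSeries n, Irreducible a → Prime a) :
    UniqueFactorizationMonoid (convSeries n) where
  irreducible_iff_prime {a} := ⟨h a, Prime.irreducible⟩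

/-- Induction on the number of variables, with Weierstrass preparation and Gauss's lemma in the
step. With no variables the ring is a field and has no irreducible elements. -/
instance instUniqueFactorizationMonoid : UniqueFactorizationMonoid (convSeries n) := by
  induction n with
  | zero =>
    refine uniqueFactorizationMonoid_of_prime fun a ha => (ha.not_isUnit ?_).elim
    rw [isUnit_iff]
    intro h0
    refine ha.ne_zero (Subtype.ext (MvPowerSeries.ext fun m => ?_))
    rw [Subsingleton.elim m 0]
    exact h0
  | succ n ih =>
    refine uniqueFactorizationMonoid_of_prime fun h hh => ?_
    obtain ⟨σ, A, P, -, -, hP, hPh, hPi⟩ := exists_isWeierstrass hh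
    exact (MulEquiv.prime_iff σ).1 (hPh.prime_iff.2 (hP.prime hPi))

end factorization

/-! ### The Nullstellensatz for hypersurface germs -/

/-- Over the fraction field P stays irreducible, hence is coprime to R, which has smaller degree.
Clearing denominators in a Bézout identity leaves a constant D, a substitute for the resultant. -/
theorem exists_mul_add_mul_eq_C {A : Type*} [CommRing A] [IsDomain A] [IsIntegrallyClosed A]
    {P R : Polynomial A} (hP : P.Monic) (hPi : Irreducible P) (hR : R.degree < P.degree)
    (hR0 : R ≠ 0) : ∃ (U V : Polynomial A) (D : A), D ≠ 0 ∧ U * P + V * R = Polynomial.C D := by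
  let K := FractionRing A
  have hinj : Function.Injective (algebraMap A K) := IsFractionRing.injective A K
  have h1 : Irreducible (P.map (algebraMap A K)) :=
    (hP.irreducible_iff_irreducible_map_fraction_map (K := K)).1 hPi
  have h2 : ¬ P.map (algebraMap A K) ∣ R.map (algebraMap A K) := by
    intro hd
    have := Polynomial.degree_le_of_dvd hd (by
      rwa [ne_eq, Polynomial.map_eq_zero_iff hinj])
    rw [Polynomial.degree_map_eq_of_injective hinj,
      Polynomial.degree_map_eq_of_injective hinj] at this
    exact absurd hR (not_lt.2 this)
  obtain ⟨u, v, huv⟩ := h1.coprime_iff_not_dvd.2 h2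
  obtain ⟨b, hb, hu⟩ := IsLocalization.integerNormalization_spec (nonZeroDivisors A) u
  obtain ⟨c, hc, hv⟩ := IsLocalization.integerNormalization_spec (nonZeroDivisors A) v
  refine ⟨Polynomial.C c * IsLocalization.integerNormalization (nonZeroDivisors A) u,
    Polynomial.C b * IsLocalization.integerNormalization (nonZeroDivisors A) v, b * c,
    mul_ne_zero (nonZeroDivisors.ne_zero hb) (nonZeroDivisors.ne_zero hc), ?_⟩
  refine Polynomial.map_injective _ hinj ?_
  have hs : ∀ (a : A) (p : Polynomial K), a • p = Polynomial.C (algebraMap A K a) * p := by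
    intro a p
    rw [← Polynomial.smul_eq_C_mul, algebraMap_smul]
  simp only [Polynomial.map_add, Polynomial.map_mul, Polynomial.map_C, hu, hv, hs, map_mul]
  linear_combination Polynomial.C (algebraMap A K b) * Polynomial.C (algebraMap A K c) * huv

/-- Up to sign the constant coefficient is the product of the roots, so they cannot all have modulus
at least ε. -/
theorem exists_root_norm_lt {p : Polynomial ℂ} (hp : p.Monic) {ε : ℝ} (hε : 0 < ε)
    (h : ‖p.coeff 0‖ < ε ^ p.natDegree) : ∃ z, ‖z‖ < ε ∧ p.eval z = 0 := by
  by_contra! hcon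
  have h1 : ∀ s : Multiset ℂ, (∀ a ∈ s, ε ≤ ‖a‖) → ε ^ Multiset.card s ≤ ‖s.prod‖ := by
    intro s
    induction s using Multiset.induction_on with
    | empty => simp
    | cons a s ih =>
      intro hs
      rw [Multiset.card_cons, Multiset.prod_cons, norm_mul, pow_succ, mul_comm]
      exact mul_le_mul (hs a (Multiset.mem_cons_self a s))
        (ih fun b hb => hs b (Multiset.mem_cons_of_mem hb)) (by positivity) (norm_nonneg _)
  have h2 := h1 p.roots fun a ha => by
    by_contra! hlt
    exact hcon a hlt (Polynomial.isRoot_of_mem_roots ha)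
  have hsp := IsAlgClosed.splits p
  rw [hsp.coeff_zero_eq_prod_roots_of_monic hp, norm_mul, norm_pow, norm_neg, norm_one, one_pow,
    one_mul, hsp.natDegree_eq_card_roots] at h
  exact absurd h (not_lt.2 h2)

section nullstellensatz

variable {n : ℕ}

theorem eventually_norm_value_lt {f : convSeries n}
    (hf : constantCoeff (f : MvPowerSeries (Fin n) ℂ) = 0) {ε : ℝ} (hε : 0 < ε) :
    ∀ᶠ z in 𝓝 (0 : Fin n → ℂ), ‖value f z‖ < ε := by
  obtain ⟨w, hw, h⟩ := exists_wnorm_le f.2 hf (ε := ENNReal.ofReal (ε / 2)) (by simpa using hε)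
  filter_upwards [eventually_enorm_le hw] with z hz
  have h1 : ‖value f z‖ₑ ≤ ENNReal.ofReal (ε / 2) := by
    refine enorm_tsum_le_tsum_enorm.trans ?_
    rw [← wnorm_enorm_eq]
    exact (wnorm_mono hz _).trans h
  rw [← ofReal_norm, ENNReal.ofReal_le_ofReal_iff (by positivity)] at h1
  linarith

theorem not_irreducible_of_isEmpty (h : convSeries 0) : ¬ Irreducible h := by
  intro hh
  refine hh.not_isUnit ((isUnit_iff h).2 fun h0 => hh.ne_zero ?_)
  refine Subtype.ext (MvPowerSeries.ext fun m => ?_)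
  rw [Subsingleton.elim m 0]
  exact h0

theorem value_one (z : Fin n → ℂ) : value (1 : convSeries n) z = 1 := by
  have := sumAt_C (z := z) 1
  rwa [map_one] at this

theorem IsWeierstrass.natDegree_pos {P : Polynomial (convSeries n)} (hP : IsWeierstrass P)
    (hPi : Irreducible P) : 0 < P.natDegree := by
  rw [Nat.pos_iff_ne_zero]
  intro h
  rw [hP.1.natDegree_eq_zero.1 h] at hPi
  exact hPi.not_isUnit isUnit_one

/-- The zero set of a Weierstrass polynomial projects onto a neighbourhood of the origin. -/
theorem IsWeierstrass.eventually_of_zeros {P : Polynomial (convSeries n)} (hP : IsWeierstrass P)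
    (hd : 0 < P.natDegree) {p : (Fin n → ℂ) → Prop}
    (h : ∀ᶠ z in 𝓝 (0 : Fin (n + 1) → ℂ), value (polyMap P) z = 0 → p (Fin.tail z)) :
    ∀ᶠ y in 𝓝 (0 : Fin n → ℂ), p y := by
  obtain ⟨ε, hε, hball⟩ := Metric.eventually_nhds_iff.1 (h.and (eventually_value_polyMap P))
  have h1 := eventually_norm_value_lt (hP.2 0 hd) (pow_pos hε P.natDegree)
  filter_upwards [h1, Metric.ball_mem_nhds 0 hε] with y hy1 hy2
  -- The specialization of P at y. Its constant coefficient is below ε^d, so it has a root t with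
  -- |t| < ε, and (t, y) is a zero of P above y within the given ball.
  let q : Polynomial ℂ := ∑ k ∈ Finset.range (P.natDegree + 1),
    Polynomial.monomial k (value (P.coeff k) y)
  have hqc : ∀ k ≤ P.natDegree, q.coeff k = value (P.coeff k) y := by
    intro k hk
    simp only [q, Polynomial.finsetSum_coeff, Polynomial.coeff_monomial, Finset.sum_ite_eq',
      Finset.mem_range]
    rw [if_pos (by omega)]
  have hqd : q.natDegree ≤ P.natDegree := by
    refine Polynomial.natDegree_sum_le_of_forall_le _ _ fun k hk => ?_
    exact (Polynomial.natDegree_monomial_le _).trans (by simpa [Nat.lt_succ_iff] using hk)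
  have hlead : q.coeff P.natDegree = 1 := by
    rw [hqc _ le_rfl, hP.1.coeff_natDegree, value_one]
  have hqd' : q.natDegree = P.natDegree :=
    le_antisymm hqd (Polynomial.le_natDegree_of_ne_zero (by rw [hlead]; exact one_ne_zero))
  have hqm : q.Monic := by
    rw [Polynomial.Monic, Polynomial.leadingCoeff, hqd', hlead]
  obtain ⟨t, ht, hroot⟩ := exists_root_norm_lt hqm hε (by rwa [hqc 0 (Nat.zero_le _), hqd'])
  have hnorm : dist (Fin.cons t y : Fin (n + 1) → ℂ) 0 < ε := by
    rw [dist_zero_right, pi_norm_lt_iff hε, Fin.forall_fin_succ]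
    refine ⟨by simpa using ht, fun i => ?_⟩
    rw [Fin.cons_succ]
    exact (norm_le_pi_norm y i).trans_lt (by simpa using hy2)
  obtain ⟨h2, h3⟩ := hball hnorm
  rw [Fin.tail_cons] at h2 h3
  refine h2 ?_
  rw [h3, ← hroot]
  simp [q, Polynomial.eval_finsetSum]

/-- The remainder R of a vanishes on {P = 0}. If R ≠ 0, so does some D = U P + V R ≠ 0 free of x₀;
but {P = 0} projects onto a neighbourhood of 0, which forces D = 0. -/
theorem IsWeierstrass.dvd_of_vanishing {P : Polynomial (convSeries n)} (hP : IsWeierstrass P)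
    (hPi : Irreducible P) {a : convSeries (n + 1)}
    (ha : ∀ᶠ z in 𝓝 (0 : Fin (n + 1) → ℂ), value (polyMap P) z = 0 → value a z = 0) :
    polyMap P ∣ a := by
  obtain ⟨q, R, hqR, hR⟩ := hP.exists_div a
  rcases eq_or_ne R 0 with rfl | hR0
  · rw [hqR, map_zero, add_zero]
    exact dvd_mul_left _ _
  exfalso
  obtain ⟨U, V, D, hD, hUV⟩ := exists_mul_add_mul_eq_C hP.1 hPi hR hR0
  refine hD (eq_zero_of_eventually_value_eq_zero
    (hP.eventually_of_zeros (hP.natDegree_pos hPi) ?_))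
  have hUV' : lift D = polyMap U * polyMap P + polyMap V * polyMap R := by
    rw [← polyMap_C, ← hUV, map_add, map_mul, map_mul]
  filter_upwards [ha, eventually_value_lift D, eventually_value_mul (polyMap U) (polyMap P),
    eventually_value_mul (polyMap V) (polyMap R),
    eventually_value_add (polyMap U * polyMap P) (polyMap V * polyMap R),
    eventually_value_mul q (polyMap P), eventually_value_add (q * polyMap P) (polyMap R)]
    with z h1 h2 h3 h4 h5 h6 h7 hz
  have hR' : value (polyMap R) z = 0 := by
    have := h1 hz
    rwa [hqR, h7, h6, hz, mul_zero, zero_add] at this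
  rw [← h2, hUV', h5, h3, h4, hz, hR']
  simp

/-- A convergent power series which vanishes on the germ `h = 0`, with `h` irreducible, is a
multiple of `h`. -/
theorem dvd_of_vanishing {h a : convSeries n} (hh : Irreducible h)
    (ha : ∀ᶠ z in 𝓝 (0 : Fin n → ℂ), value h z = 0 → value a z = 0) : h ∣ a := by
  cases n with
  | zero => exact (not_irreducible_of_isEmpty h hh).elim
  | succ n =>
    obtain ⟨σ, A, P, hA, -, hP, hPh, hPi⟩ := exists_isWeierstrass hh
    have hlim : Tendsto A (𝓝 0) (𝓝 0) := by
      simpa using A.continuous.tendsto 0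
    obtain ⟨u, hu⟩ := hPh
    have key : polyMap P ∣ σ a := by
      refine hP.dvd_of_vanishing hPi ?_
      have huinv : σ h = polyMap P * (u⁻¹ : (convSeries (n + 1))ˣ) := by
        rw [← hu, mul_assoc, Units.mul_inv, mul_one]
      filter_upwards [hA h, hA a, hlim.eventually ha, eventually_value_mul (polyMap P)
        (u⁻¹ : (convSeries (n + 1))ˣ)] with z h1 h2 h3 h4 hz
      rw [h2]
      refine h3 ?_
      rw [← h1, huinv, h4, hz, zero_mul]
    have h2 : σ h ∣ σ a := (Dvd.intro _ hu).trans key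
    exact (map_dvd_iff σ).1 h2

end nullstellensatz

/-! ### Algebraic preliminaries -/

section algebra

/-- The coefficient vectors are d + 1 elements of the free module A^d. -/
theorem exists_relation_of_degree_lt {A : Type*} [CommRing A] [Nontrivial A] {d : ℕ}
    (R : ℕ → Polynomial A) (hR : ∀ i, (R i).degree < d) :
    ∃ q : ℕ → A, ∑ i ∈ Finset.range (d + 1), Polynomial.C (q i) * R i = 0 ∧ ∃ i ≤ d, q i ≠ 0 := by
  let v : Fin (d + 1) → Fin d → A := fun i k => (R i).coeff k
  have hv : ¬ LinearIndependent A v := by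
    intro h
    have := h.fintype_card_le_finrank
    simp at this
  obtain ⟨g, hg, i, hi⟩ := Fintype.not_linearIndependent_iff.1 hv
  let q : ℕ → A := fun j => if hj : j < d + 1 then g ⟨j, hj⟩ else 0
  have hq : ∀ j : Fin (d + 1), q j = g j := fun j => dif_pos j.2
  refine ⟨q, ?_, i, Nat.lt_succ_iff.1 i.2, by rwa [hq]⟩
  ext k
  rw [Polynomial.finsetSum_coeff, Polynomial.coeff_zero]
  simp only [Polynomial.coeff_C_mul]
  by_cases hk : k < d
  · have := congrFun hg ⟨k, hk⟩
    rw [Finset.sum_range fun i => q i * (R i).coeff k]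
    simpa [v, hq] using this
  · refine Finset.sum_eq_zero fun j _ => ?_
    rw [Polynomial.coeff_eq_zero_of_degree_lt ((hR j).trans_le (by exact_mod_cast not_lt.1 hk)),
      mul_zero]

variable {B : Type*} [CommRing B]

/-- The homogeneous form `∑ᵢ aᵢ Fⁱ Gᵐ⁻ⁱ`. -/
def form (F G : B) (m : ℕ) (a : ℕ → B) : B := ∑ i ∈ Finset.range (m + 1), a i * F ^ i * G ^ (m - i)

/-- The first term depends on i and j only through the degree i + j, so it sums to a multiple of a
homogeneous form; the second is a multiple of the Wronskian. -/
theorem mul_derivation_pow_mul_pow {k : Type*} [CommRing k] [Algebra k B] (D : Derivation k B B)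
    (F G : B) (i j : ℕ) :
    G * D (F ^ i * G ^ j) = ((i + j : ℕ) : B) * (F ^ i * G ^ j) * D G +
      (i : B) * F ^ (i - 1) * G ^ j * (G * D F - F * D G) := by
  rw [Derivation.leibniz, Derivation.leibniz_pow, Derivation.leibniz_pow]
  simp only [smul_eq_mul, nsmul_eq_mul]
  rcases i with - | i <;> rcases j with - | j
  · simp
  · simp [pow_succ]; ring
  · simp [pow_succ]; ring
  · simp [pow_succ]; ring

/-- Modulo π, F / G behaves as a constant for D. Thus G times the derivative of the form is G times
the form with differentiated coefficients, and it is also G s Dπ; then G is cancelled. -/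
theorem dvd_form_derivation {k : Type*} [CommRing k] [Algebra k B] (D : Derivation k B B)
    {π F G s : B} (hπ : Prime π) (hG : ¬ π ∣ G) (hD : π ∣ G * D F - F * D G) {m : ℕ} {a : ℕ → B}
    (hs : form F G m a = π * s) : π ∣ form F G m (fun i => D (a i)) - s * D π := by
  refine (hπ.dvd_or_dvd ?_).resolve_left hG
  have h1 : ∀ i ∈ Finset.range (m + 1), G * D (a i * F ^ i * G ^ (m - i)) =
      G * (D (a i) * F ^ i * G ^ (m - i)) + m * D G * (a i * F ^ i * G ^ (m - i)) +
        (G * D F - F * D G) * (a i * (i : B) * F ^ (i - 1) * G ^ (m - i)) := by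
    intro i hi
    have h2 := mul_derivation_pow_mul_pow D F G i (m - i)
    rw [Nat.add_sub_cancel' (Nat.lt_succ_iff.1 (Finset.mem_range.1 hi))] at h2
    rw [mul_assoc, Derivation.leibniz]
    simp only [smul_eq_mul]
    linear_combination a i * h2
  have h3 : G * D (form F G m a) = G * form F G m (fun i => D (a i)) + m * D G * form F G m a +
      (G * D F - F * D G) *
        ∑ i ∈ Finset.range (m + 1), a i * (i : B) * F ^ (i - 1) * G ^ (m - i) := by
    simp only [form, map_sum, Finset.mul_sum]
    rw [Finset.sum_congr rfl h1, Finset.sum_add_distrib, Finset.sum_add_distrib]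
  obtain ⟨e, he⟩ := hD
  rw [hs, Derivation.leibniz, he] at h3
  simp only [smul_eq_mul] at h3
  refine ⟨G * D s - m * D G * s - e * ∑ i ∈ Finset.range (m + 1),
    a i * (i : B) * F ^ (i - 1) * G ^ (m - i), ?_⟩
  linear_combination -h3

/-- While the leading coefficient is zero, the form has a factor G, which can be cancelled modulo π.
-/
theorem exists_dvd_form {π F G : B} (hπ : Prime π) (hG : ¬ π ∣ G) {m : ℕ} {a : ℕ → B}
    (h : π ∣ form F G m a) (ha : ∃ i ≤ m, a i ≠ 0) : ∃ j ≤ m, a j ≠ 0 ∧ π ∣ form F G j a := by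
  induction m with
  | zero =>
    obtain ⟨i, hi, hai⟩ := ha
    obtain rfl : i = 0 := by omega
    exact ⟨0, le_rfl, hai, h⟩
  | succ m ih =>
    by_cases hm : a (m + 1) = 0
    · have h1 : form F G (m + 1) a = G * form F G m a := by
        rw [form, Finset.sum_range_succ, hm, form, Finset.mul_sum]
        simp only [zero_mul, add_zero]
        refine Finset.sum_congr rfl fun i hi => ?_
        rw [Nat.succ_sub (Nat.lt_succ_iff.1 (Finset.mem_range.1 hi)), pow_succ]
        ring
      rw [h1] at h
      obtain ⟨i, hi, hai⟩ := ha
      have hi' : i ≤ m := by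
        rcases Nat.le_succ_iff.1 hi with h' | h'
        · exact h'
        · exact (hai (h' ▸ hm)).elim
      obtain ⟨j, hj, h2⟩ := ih ((hπ.dvd_or_dvd h).resolve_left hG) ⟨i, hi', hai⟩
      exact ⟨j, hj.trans (Nat.le_succ m), h2⟩
    · exact ⟨m + 1, le_rfl, hm, h⟩

/-- In the fraction field of B/(π), F / G is a root of a nonzero polynomial over the algebraically
closed field k, hence lies in k. -/
theorem exists_dvd_sub_smul_of_form {k : Type*} [Field k] [IsAlgClosed k] [Algebra k B]
    {π F G : B} (hπ : Prime π) (hG : ¬ π ∣ G) {m : ℕ} {c : ℕ → k} (hc : c m ≠ 0)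
    (h : π ∣ form F G m fun i => algebraMap k B (c i)) : ∃ a : k, π ∣ F - a • G := by
  let Q := B ⧸ Ideal.span {π}
  have hprime : (Ideal.span {π}).IsPrime := (Ideal.span_singleton_prime hπ.ne_zero).2 hπ
  let K := FractionRing Q
  have hmk : ∀ b : B, algebraMap B K b = 0 ↔ π ∣ b := by
    intro b
    rw [IsScalarTower.algebraMap_apply B Q K, map_eq_zero_iff _ (IsFractionRing.injective Q K)]
    exact Ideal.Quotient.eq_zero_iff_dvd π b
  have hG' : algebraMap B K G ≠ 0 := fun h0 => hG ((hmk G).1 h0)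
  let x : K := algebraMap B K F / algebraMap B K G
  let p : Polynomial k := ∑ i ∈ Finset.range (m + 1), Polynomial.monomial i (c i)
  have hp : p ≠ 0 := by
    intro h0
    have := congrArg (Polynomial.coeff · m) h0
    simp [p, Polynomial.coeff_monomial] at this
    exact hc this
  have hpx : Polynomial.aeval x p = 0 := by
    have h1 : algebraMap B K (form F G m fun i => algebraMap k B (c i)) = 0 := (hmk _).2 h
    have h2 : algebraMap B K (form F G m fun i => algebraMap k B (c i)) =
        algebraMap B K G ^ m * Polynomial.aeval x p := by
      simp only [form, p, map_sum, map_mul, map_pow, Polynomial.aeval_monomial, Finset.mul_sum,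
        x, div_pow]
      refine Finset.sum_congr rfl fun i hi => ?_
      have hi' := Nat.lt_succ_iff.1 (Finset.mem_range.1 hi)
      obtain ⟨l, rfl⟩ := Nat.exists_eq_add_of_le hi'
      rw [← IsScalarTower.algebraMap_apply k B K, Nat.add_sub_cancel_left, pow_add]
      have hGi := mul_inv_cancel₀ (pow_ne_zero i hG')
      rw [div_eq_mul_inv]
      linear_combination (-(algebraMap k K (c i) * algebraMap B K F ^ i * algebraMap B K G ^ l)) *
        hGi
    rw [h2] at h1
    exact (mul_eq_zero.1 h1).resolve_left (pow_ne_zero _ hG')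
  have hint : IsIntegral k x := isAlgebraic_iff_isIntegral.1 ⟨p, hp, hpx⟩
  obtain ⟨a, ha⟩ := minpoly.mem_range_of_degree_eq_one k x
    (IsAlgClosed.degree_eq_one_of_irreducible k (minpoly.irreducible hint))
  refine ⟨a, (hmk _).1 ?_⟩
  have h3 : algebraMap k K a * algebraMap B K G = algebraMap B K F := by
    rw [ha]
    exact div_mul_cancel₀ _ hG'
  rw [map_sub, Algebra.smul_def, map_mul, ← IsScalarTower.algebraMap_apply k B K, h3, sub_self]

end algebra

/-! ### Logarithmic derivatives -/

section constants

variable {n : ℕ}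

theorem isUnit_natCast {m : ℕ} (hm : m ≠ 0) : IsUnit (m : convSeries n) := by
  have h1 : IsUnit (algebraMap ℂ (convSeries n) m) :=
    (IsUnit.mk0 (m : ℂ) (Nat.cast_ne_zero.2 hm)).map _
  rwa [map_natCast] at h1

instance : IsAddTorsionFree (convSeries n) :=
  ⟨fun m hm a b hab => by
    simp only [nsmul_eq_mul] at hab
    exact (isUnit_natCast hm).mul_left_cancel hab⟩

/-- Differentiating a monomial of lowest degree, with respect to a variable in it, lowers the order
of b, whereas a multiple of b has at least its order. -/
theorem exists_not_dvd_pd {b : convSeries n} (hb : b ≠ 0) (hu : ¬ IsUnit b) :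
    ∃ k, ¬ b ∣ pd k b := by
  by_contra! hcon
  have hb' : (b : MvPowerSeries (Fin n) ℂ) ≠ 0 := fun h0 => hb (Subtype.ext h0)
  obtain ⟨m, hm, hdeg⟩ := exists_coeff_ne_zero_and_order (ne_zero_iff_order_finite.1 hb')
  have hm0 : m ≠ 0 := by
    rintro rfl
    exact hu ((isUnit_iff b).2 hm)
  obtain ⟨k, hk⟩ := Finsupp.ne_iff.1 hm0
  have hle : Finsupp.single k 1 ≤ m := by
    simpa using Nat.one_le_iff_ne_zero.2 hk
  obtain ⟨m', rfl⟩ := exists_add_of_le hle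
  obtain ⟨q, hq⟩ := hcon k
  have h1 : coeff m' (pd k b : MvPowerSeries (Fin n) ℂ) ≠ 0 := by
    change coeff m' (MvPowerSeries.pderiv ℂ k (b : MvPowerSeries (Fin n) ℂ)) ≠ 0
    rw [coeff_pderiv, add_comm m']
    exact mul_ne_zero hm (Nat.cast_add_one_ne_zero _)
  refine h1 (coeff_of_lt_order ?_)
  rw [hq, MulMemClass.coe_mul, order_mul, ← hdeg, map_add, Finsupp.degree_single]
  refine lt_of_lt_of_le ?_ le_self_add
  exact_mod_cast (by omega : m'.degree < 1 + m'.degree)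

/-- The fraction a / b has zero differential. In lowest terms its denominator divides all of its own
derivatives, so it is a unit; a power series with zero differential is constant. -/
theorem exists_eq_smul_of_pd_eq {a b : convSeries n} (hb : b ≠ 0)
    (h : ∀ k, b * pd k a = a * pd k b) : ∃ c : ℂ, a = c • b := by
  obtain ⟨b', a', d, hrel, rfl, rfl⟩ := UniqueFactorizationMonoid.exists_reduced_factors b hb a
  have hd : d ≠ 0 := left_ne_zero_of_mul hb
  have hb' : b' ≠ 0 := right_ne_zero_of_mul hb
  have h1 : ∀ k, b' * pd k a' = a' * pd k b' := by
    intro k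
    have h2 := h k
    rw [Derivation.leibniz, Derivation.leibniz] at h2
    simp only [smul_eq_mul] at h2
    refine mul_left_cancel₀ (mul_ne_zero hd hd) ?_
    linear_combination h2
  have hunit : IsUnit b' := by
    by_contra hu
    obtain ⟨k, hk⟩ := exists_not_dvd_pd hb' hu
    exact hk (hrel.dvd_of_dvd_mul_left (Dvd.intro _ (h1 k)))
  obtain ⟨e, rfl⟩ := hunit.dvd (a := a')
  have he : ∀ k, pd k e = 0 := by
    intro k
    have h2 := h1 k
    rw [Derivation.leibniz] at h2
    simp only [smul_eq_mul] at h2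
    refine mul_left_cancel₀ (mul_ne_zero hb' hb') ?_
    linear_combination h2
  refine ⟨constantCoeff (e : MvPowerSeries (Fin n) ℂ), ?_⟩
  have hec : e = algebraMap ℂ (convSeries n) (constantCoeff (e : MvPowerSeries (Fin n) ℂ)) := by
    refine Subtype.ext (MvPowerSeries.pderiv.ext (fun i => ?_) ?_)
    · refine (congrArg Subtype.val (he i)).trans ?_
      exact (pderiv_C (R := ℂ)).symm
    · exact (constantCoeff_C _).symm
  rw [Algebra.smul_def, ← hec]
  ring

/-- A homogeneous relation of minimal degree between F and G modulo P, over the series free of x₀,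
has coefficients proportional to constants. -/
theorem IsWeierstrass.exists_dvd_sub_smul {P : Polynomial (convSeries n)} (hP : IsWeierstrass P)
    (hPi : Irreducible P) {F G : convSeries (n + 1)} (hG : ¬ polyMap P ∣ G)
    (hW : ∀ k, polyMap P ∣ G * pd k F - F * pd k G) : ∃ c : ℂ, polyMap P ∣ F - c • G := by
  have hπ : Prime (polyMap P) := hP.prime hPi
  have hd := hP.natDegree_pos hPi
  have hPd : P.degree = P.natDegree := Polynomial.degree_eq_natDegree hP.1.ne_zero
  -- a relation exists
  have hex : ∃ m, ∃ q : ℕ → convSeries n, q m ≠ 0 ∧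
      polyMap P ∣ form F G m fun i => lift (q i) := by
    -- The d + 1 monomials of degree d in F and G have remainders of degree less than d = deg P, so
    -- these are linearly dependent over the series free of x₀.
    choose Q R hQR hRd using fun i => hP.exists_div (F ^ i * G ^ (P.natDegree - i))
    rw [hPd] at hRd
    obtain ⟨q, hq, i, hi, hqi⟩ := exists_relation_of_degree_lt R hRd
    have h1 : polyMap P ∣ form F G P.natDegree fun i => lift (q i) := by
      refine ⟨∑ i ∈ Finset.range (P.natDegree + 1), lift (q i) * Q i, ?_⟩
      have h2 := congrArg polyMap hq
      rw [map_sum, map_zero] at h2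
      simp only [map_mul, polyMap_C] at h2
      rw [form, Finset.mul_sum, ← sub_eq_zero, ← Finset.sum_sub_distrib, ← h2]
      refine Finset.sum_congr rfl fun i _ => ?_
      rw [mul_assoc, hQR]
      ring
    obtain ⟨j, -, hj, hdvd⟩ := exists_dvd_form hπ hG h1
      ⟨i, hi, fun h0 => hqi (lift_injective (h0.trans (map_zero lift).symm))⟩
    exact ⟨j, q, fun h0 => hj (by rw [h0, map_zero]), hdvd⟩
  classical
  let m := Nat.find hex
  obtain ⟨q, hqm, hq⟩ : ∃ q : ℕ → convSeries n, q m ≠ 0 ∧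
      polyMap P ∣ form F G m fun i => lift (q i) := Nat.find_spec hex
  -- the derivatives of the coefficients give another relation
  have hder : ∀ k, polyMap P ∣ form F G m fun i => lift (pd k (q i)) := by
    intro k
    obtain ⟨s, hs⟩ := hq
    have h0 := dvd_form_derivation (pd 0) hπ hG (hW 0) hs
    have h1 := dvd_form_derivation (pd k.succ) hπ hG (hW k.succ) hs
    -- The coefficients do not involve x₀, so ∂/∂x₀ leaves only s ∂P/∂x₀. As ∂P/∂x₀ is nonzero of
    -- smaller degree, P divides s, and the error term disappears for the other derivatives.
    have h2 : polyMap P ∣ s := by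
      have h3 : form F G m (fun i => pd 0 (lift (q i))) = 0 := by
        simp [form, pd_zero_lift]
      rw [h3, zero_sub, pd_zero_polyMap] at h0
      refine (hπ.dvd_or_dvd (dvd_neg.1 h0)).resolve_right fun h4 => ?_
      have h5 := hP.eq_zero_of_dvd (Polynomial.degree_derivative_lt hP.1.ne_zero) h4
      exact hd.ne' (Polynomial.derivative_eq_zero.1 h5)
    simp only [pd_succ_lift] at h1
    have h6 := dvd_add h1 (h2.mul_right (pd k.succ (polyMap P)))
    rwa [sub_add_cancel] at h6
  have hconst : ∀ i ≤ m, ∃ c : ℂ, q i = c • q m := by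
    intro i hi
    refine exists_eq_smul_of_pd_eq hqm fun k => ?_
    -- This combination of the two relations cancels the coefficient of index m, so by minimality
    -- all q' i with i ≤ m vanish: each q i / q m has zero differential.
    let q' : ℕ → convSeries n := fun i => q m * pd k (q i) - q i * pd k (q m)
    have hq' : polyMap P ∣ form F G m fun i => lift (q' i) := by
      have h1 : form F G m (fun i => lift (q' i)) =
          lift (q m) * form F G m (fun i => lift (pd k (q i))) -
            lift (pd k (q m)) * form F G m (fun i => lift (q i)) := by
        simp only [form, Finset.mul_sum, ← Finset.sum_sub_distrib, q', map_sub, map_mul]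
        exact Finset.sum_congr rfl fun i _ => by ring
      rw [h1]
      exact dvd_sub ((hder k).mul_left _) (hq.mul_left _)
    by_contra hne
    have hne' : lift (q' i) ≠ 0 := fun h0 =>
      hne (sub_eq_zero.1 (lift_injective (h0.trans (map_zero lift).symm)))
    obtain ⟨j, hj, hj0, hdvd⟩ := exists_dvd_form hπ hG hq' ⟨i, hi, hne'⟩
    have hjm : j ≠ m := by
      rintro rfl
      refine hj0 ?_
      have : q' m = 0 := by simp only [q']; ring
      rw [this, map_zero]
    exact Nat.find_min hex (lt_of_le_of_ne hj hjm)
      ⟨q', fun h0 => hj0 (by rw [h0, map_zero]), hdvd⟩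
  choose! c hc using hconst
  have hcm : c m ≠ 0 := by
    intro h0
    have := hc m le_rfl
    rw [h0, zero_smul] at this
    exact hqm this
  refine exists_dvd_sub_smul_of_form hπ hG hcm ?_
  have h1 : form F G m (fun i => lift (q i)) =
      lift (q m) * form F G m fun i => algebraMap ℂ (convSeries (n + 1)) (c i) := by
    rw [form, form, Finset.mul_sum]
    refine Finset.sum_congr rfl fun i hi => ?_
    rw [hc i (Nat.lt_succ_iff.1 (Finset.mem_range.1 hi)), map_smul, Algebra.smul_def]
    ring
  rw [h1] at hq
  -- P cannot divide the nonzero `lift (q m)`, which has degree 0 in x₀.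
  refine (hπ.dvd_or_dvd hq).resolve_left fun h2 => hqm ?_
  rw [← polyMap_C] at h2
  have h3 := hP.eq_zero_of_dvd (Polynomial.degree_C_le.trans_lt (by rw [hPd]; exact_mod_cast hd)) h2
  exact Polynomial.C_eq_zero.1 h3

/-- If `d (f / g)` vanishes along the irreducible hypersurface germ `h = 0`, then `f / g` is
constant on it. -/
theorem exists_dvd_sub_smul {h f g : convSeries n} (hh : Irreducible h) (hg : ¬ h ∣ g)
    (hW : ∀ k, h ∣ g * pd k f - f * pd k g) : ∃ c : ℂ, h ∣ f - c • g := by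
  cases n with
  | zero => exact (not_irreducible_of_isEmpty h hh).elim
  | succ n =>
    obtain ⟨σ, A, P, -, hpd, hP, hPh, hPi⟩ := exists_isWeierstrass hh
    have hdvd : ∀ a, polyMap P ∣ σ a ↔ h ∣ a := fun a => by
      rw [← hPh.dvd_iff_dvd_left]
      exact map_dvd_iff σ
    obtain ⟨c, hc⟩ := hP.exists_dvd_sub_smul hPi (F := σ f) (G := σ g) (by rwa [hdvd]) (by
      -- By the chain rule, the Wronskians of σ f and σ g are constant combinations of the images
      -- under σ of those of f and g.
      intro k
      obtain ⟨c, hc⟩ := hpd k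
      have : σ g * pd k (σ f) - σ f * pd k (σ g) =
          σ (∑ j, c j • (g * pd j f - f * pd j g)) := by
        rw [hc, hc, Finset.mul_sum, Finset.mul_sum, ← Finset.sum_sub_distrib, map_sum]
        refine Finset.sum_congr rfl fun j _ => ?_
        rw [map_smul, map_sub, map_mul, map_mul, smul_sub, mul_smul_comm, mul_smul_comm]
      rw [this, hdvd]
      refine Finset.dvd_sum fun j _ => ?_
      rw [Algebra.smul_def]
      exact (hW j).mul_left _)
    refine ⟨c, (hdvd _).1 ?_⟩
    rwa [map_sub, map_smul]

end constants

/-! ### Hypersurface components of analytic germs -/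

section components

variable {n : ℕ}

theorem eventually_mem_zeros_of_dvd {h : convSeries n} {S : Set (convSeries n)} (hS : S.Finite)
    (hdvd : ∀ a ∈ S, h ∣ a) : ∀ᶠ z in 𝓝 (0 : Fin n → ℂ), value h z = 0 → z ∈ zeros S := by
  have : ∀ᶠ z in 𝓝 (0 : Fin n → ℂ), ∀ a ∈ S, value h z = 0 → value a z = 0 := by
    rw [eventually_all_finite hS]
    intro a ha
    obtain ⟨b, rfl⟩ := hdvd a ha
    filter_upwards [eventually_value_mul h b] with z hz h0
    rw [hz, h0, zero_mul]
  filter_upwards [this] with z hz h0 a ha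
  exact hz a ha h0

theorem mem_zeros_singleton {h : convSeries n} {z : Fin n → ℂ} :
    z ∈ zeros {h} ↔ value h z = 0 := by
  simp [zeros]

/-- If neither piece is all of {h = 0}, each has an equation that h does not divide. Their product
vanishes on {h = 0}, so h divides it, against primality. -/
theorem isIrreducibleGerm_zeros {h : convSeries n} (hh : Irreducible h) :
    IsIrreducibleGerm (zeros {h}) := by
  have hp : Prime h := UniqueFactorizationMonoid.irreducible_iff_prime.1 hh
  refine ⟨⟨{h}, Set.finite_singleton h, EventuallyEq.rfl⟩, fun hempty => ?_, ?_⟩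
  · have h1 := (eventuallyEq_set.1 hempty).self_of_nhds
    refine (h1.1 (mem_zeros_singleton.2 ?_)).elim
    rw [value_at_zero]
    by_contra h0
    exact hh.not_isUnit ((isUnit_iff h).2 h0)
  · rintro Y Z ⟨S, hS, hYS⟩ ⟨T, hT, hZT⟩ hYZ
    have hYS' := eventuallyEq_set.1 hYS
    have hZT' := eventuallyEq_set.1 hZT
    have hYZ' := eventuallyEq_set.1 hYZ
    by_cases h1 : ∀ a ∈ S, h ∣ a
    · left
      rw [eventuallyEq_set]
      filter_upwards [eventually_mem_zeros_of_dvd hS h1, hYS', hYZ'] with z h2 h3 h4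
      exact ⟨fun hz => h3.2 (h2 (mem_zeros_singleton.1 hz)), fun hz => h4.2 (Or.inl hz)⟩
    by_cases h2 : ∀ b ∈ T, h ∣ b
    · right
      rw [eventuallyEq_set]
      filter_upwards [eventually_mem_zeros_of_dvd hT h2, hZT', hYZ'] with z h2 h3 h4
      exact ⟨fun hz => h3.2 (h2 (mem_zeros_singleton.1 hz)), fun hz => h4.2 (Or.inr hz)⟩
    exfalso
    push Not at h1 h2
    obtain ⟨a, ha, hha⟩ := h1
    obtain ⟨b, hb, hhb⟩ := h2
    have h3 : h ∣ a * b := by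
      refine dvd_of_vanishing hh ?_
      filter_upwards [hYS', hZT', hYZ', eventually_value_mul a b] with z h4 h5 h6 h7 h8
      rw [h7]
      rcases h6.1 (mem_zeros_singleton.2 h8) with hz | hz
      · rw [h4.1 hz a ha, zero_mul]
      · rw [h5.1 hz b hb, mul_zero]
    exact (hp.dvd_or_dvd h3).elim hha hhb

/-- By the Nullstellensatz h divides every equation of W, so W is the union of {h = 0} and the zero
set of the quotients. Irreducibility selects one of them; in the second case the induction continues
with one power of h less, and N bounds the number of steps. -/
theorem IsIrreducibleGerm.eventuallyEq_zeros {h : convSeries n} (hh : Irreducible h)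
    {W : Set (Fin n → ℂ)} (hW : IsIrreducibleGerm W) (hhW : zeros {h} ≤ᶠ[𝓝 0] W) (N : ℕ)
    {S : Set (convSeries n)} (hS : S.Finite) (hWS : W =ᶠ[𝓝 0] zeros S)
    (hN : ∃ a ∈ S, ¬ h ^ N ∣ a) : W =ᶠ[𝓝 0] zeros {h} := by
  induction N generalizing S with
  | zero =>
    obtain ⟨a, -, ha⟩ := hN
    exact (ha (by rw [pow_zero]; exact one_dvd a)).elim
  | succ N ih =>
    have hdvd : ∀ a ∈ S, h ∣ a := by
      intro a ha
      refine dvd_of_vanishing hh ?_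
      filter_upwards [hhW, eventuallyEq_set.1 hWS] with z h1 h2 h3
      exact h2.1 (h1 (mem_zeros_singleton.2 h3)) a ha
    choose! q hq using hdvd
    have hev : ∀ᶠ z in 𝓝 (0 : Fin n → ℂ), ∀ a ∈ S, value a z = value h z * value (q a) z := by
      rw [eventually_all_finite hS]
      intro a ha
      filter_upwards [eventually_value_mul h (q a)] with z hz
      rw [← hz, ← hq a ha]
    have hunion : W =ᶠ[𝓝 0] (zeros {h} ∪ zeros (q '' S) : Set (Fin n → ℂ)) := by
      rw [eventuallyEq_set]
      filter_upwards [hev, eventuallyEq_set.1 hWS] with z h1 h2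
      rw [h2, Set.mem_union, mem_zeros_singleton]
      constructor
      · intro hz
        rw [or_iff_not_imp_left]
        rintro h0 - ⟨a, ha, rfl⟩
        have h3 := hz a ha
        rw [h1 a ha] at h3
        exact (mul_eq_zero.1 h3).resolve_left h0
      · rintro (hz | hz) a ha
        · rw [h1 a ha, hz, zero_mul]
        · rw [h1 a ha, hz (q a) ⟨a, ha, rfl⟩, mul_zero]
    rcases hW.2.2 _ _ ⟨{h}, Set.finite_singleton h, EventuallyEq.rfl⟩
      ⟨q '' S, hS.image q, EventuallyEq.rfl⟩ hunion with h1 | h1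
    · exact h1
    · obtain ⟨a, ha, hNa⟩ := hN
      refine ih (hS.image q) h1 ⟨q a, ⟨a, ha, rfl⟩, fun h2 => hNa ?_⟩
      rw [hq a ha, pow_succ']
      exact mul_dvd_mul_left h h2

/-- An irreducible hypersurface germ along which a nonzero `1`-form vanishes is a component of its
singular set. -/
theorem isComponent_zeros_sing {h : convSeries n} (hh : Irreducible h) {ω : OneForm n}
    (hω : ω ≠ 0) (hdvd : ∀ k, h ∣ ω k) : IsComponent (zeros {h}) (sing ω) := by
  refine ⟨isIrreducibleGerm_zeros hh, ?_, fun W hW hhW hWω => ?_⟩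
  · filter_upwards [eventually_mem_zeros_of_dvd (Set.finite_range ω)
      (by rintro - ⟨k, rfl⟩; exact hdvd k)] with z hz h0
    exact hz (mem_zeros_singleton.1 h0)
  · obtain ⟨S, hS, hWS⟩ := hW.1
    -- Otherwise W is a full neighbourhood of 0 on which ω vanishes, and then ω = 0.
    have hS0 : ∃ a ∈ S, a ≠ 0 := by
      by_contra! hcon
      refine hω (funext fun k => eq_zero_of_eventually_value_eq_zero ?_)
      filter_upwards [hWω, eventuallyEq_set.1 hWS] with z h1 h2
      refine h1 (h2.2 fun a ha => ?_) (ω k) ⟨k, rfl⟩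
      rw [hcon a ha, value_zero_left]
    obtain ⟨a, ha, ha0⟩ := hS0
    obtain ⟨N, hN⟩ := FiniteMultiplicity.of_not_isUnit hh.not_isUnit ha0
    exact hW.eventuallyEq_zeros hh hhW (N + 1) hS hWS ⟨a, ha, hN⟩

end components

/-! ### Divisibility of `θ_φ` -/

section theta

variable {n : ℕ} {f g h : convSeries n}

theorem dividesForm_iff {a : convSeries n} {ω : OneForm n} :
    DividesForm a ω ↔ ∀ k, a ∣ ω k := by
  constructor
  · rintro ⟨η, rfl⟩ k
    exact Dvd.intro (η k) rfl
  · intro h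
    choose η hη using h
    exact ⟨η, funext hη⟩

theorem Decomposition.red_dvd (D : Decomposition f) : D.red ∣ f := by
  have h1 : D.red ∣ ∏ i, D.factor i ^ D.exponent i :=
    Finset.prod_dvd_prod_of_dvd _ _ fun i _ => dvd_pow_self _ (D.exponent_pos i).ne'
  exact h1.trans (Dvd.intro_left _ D.eq_prod.symm)

/-- A residue computation: if h is associated to fᵢ, the only term not divisible by h is nᵢ ∏_{j≠i}
fⱼ dfᵢ, and h divides none of its three factors. -/
theorem Decomposition.exists_not_dvd_redLogDiff (D : Decomposition f) (hh : Prime h)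
    (hf : h ∣ f) : h ∣ D.red ∧ ∃ k, ¬ h ∣ D.redLogDiff k := by
  classical
  obtain ⟨i, hi⟩ : ∃ i, h ∣ D.factor i := by
    rw [D.eq_prod] at hf
    have h1 := (hh.dvd_or_dvd hf).resolve_left fun h2 =>
      hh.not_isUnit (isUnit_of_dvd_unit h2 D.unit.isUnit)
    obtain ⟨i, -, hi⟩ := (hh.dvd_finsetProd_iff _).1 h1
    exact ⟨i, hh.dvd_of_dvd_pow hi⟩
  have hassoc : Associated h (D.factor i) := hh.irreducible.associated_of_dvd (D.irreducible i) hi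
  have hred : h ∣ D.red := hi.trans (Finset.dvd_prod_of_mem _ (Finset.mem_univ i))
  obtain ⟨k, hk⟩ := exists_not_dvd_pd (D.irreducible i).ne_zero (D.irreducible i).not_isUnit
  refine ⟨hred, k, fun hdvd => ?_⟩
  have hsum : D.redLogDiff k = D.red * (D.unit⁻¹ : (convSeries n)ˣ) * pd k (D.unit : convSeries n) +
      ∑ j, (D.exponent j : convSeries n) * (∏ l ∈ Finset.univ.erase j, D.factor l) *
        pd k (D.factor j) := by
    simp [Decomposition.redLogDiff, diff]
  rw [hsum] at hdvd
  have h2 := (dvd_add_right ((hred.mul_right _).mul_right _)).1 hdvd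
  rw [← Finset.add_sum_erase _ _ (Finset.mem_univ i)] at h2
  have h3 : h ∣ ∑ j ∈ Finset.univ.erase i, (D.exponent j : convSeries n) *
      (∏ l ∈ Finset.univ.erase j, D.factor l) * pd k (D.factor j) := by
    refine Finset.dvd_sum fun j hj => ((hi.trans ?_).mul_left _).mul_right _
    exact Finset.dvd_prod_of_mem _ (Finset.mem_erase.2 ⟨(Finset.ne_of_mem_erase hj).symm,
      Finset.mem_univ i⟩)
  have h4 := (dvd_add_left h3).1 h2
  rcases hh.dvd_or_dvd h4 with h5 | h5
  · rcases hh.dvd_or_dvd h5 with h6 | h6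
    · exact hh.not_isUnit (isUnit_of_dvd_unit h6 (isUnit_natCast (D.exponent_pos i).ne'))
    · obtain ⟨l, hl, hhl⟩ := (hh.dvd_finsetProd_iff _).1 h6
      exact D.not_associated l i (Finset.ne_of_mem_erase hl)
        ((hh.irreducible.associated_of_dvd (D.irreducible l) hhl).symm.trans hassoc)
  · exact hk (hassoc.symm.dvd.trans h5)

/-- If h divided f, then θ_φ would be g^red · f^red (df / f) modulo h; h cannot divide g^red by
coprimality, nor the logarithmic form. -/
theorem not_dvd_left_of_dvd_theta (hfg : IsRelPrime f g) (Df : Decomposition f)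
    (Dg : Decomposition g) (hh : Prime h) (hθ : ∀ k, h ∣ theta Df Dg k) : ¬ h ∣ f := by
  intro hf
  obtain ⟨hred, k, hk⟩ := Df.exists_not_dvd_redLogDiff hh hf
  have h1 : theta Df Dg k = Dg.red * Df.redLogDiff k - Df.red * Dg.redLogDiff k := rfl
  have h2 := hθ k
  rw [h1, dvd_sub_left (hred.mul_right _)] at h2
  rcases hh.dvd_or_dvd h2 with h3 | h3
  · exact hh.not_isUnit (hfg hf (h3.trans Dg.red_dvd))
  · exact hk h3

theorem not_dvd_of_dvd_theta (hfg : IsRelPrime f g) (Df : Decomposition f)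
    (Dg : Decomposition g) (hh : Prime h) (hθ : ∀ k, h ∣ theta Df Dg k) : ¬ h ∣ f ∧ ¬ h ∣ g := by
  refine ⟨not_dvd_left_of_dvd_theta hfg Df Dg hh hθ,
    not_dvd_left_of_dvd_theta hfg.symm Dg Df hh fun k => ?_⟩
  have h1 : theta Dg Df k = -theta Df Dg k := by
    simp [theta]
  rw [h1]
  exact (dvd_neg).2 (hθ k)

/-- In `mul_theta` the factors f g and f^red g^red are prime to h, so they do not affect the order
along h. -/
theorem pow_dvd_theta_iff (Df : Decomposition f) (Dg : Decomposition g) (hh : Prime h)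
    (hf : ¬ h ∣ f) (hg : ¬ h ∣ g) (j : ℕ) (k : Fin n) :
    h ^ j ∣ theta Df Dg k ↔ h ^ j ∣ g * pd k f - f * pd k g := by
  have h1 : f * g * theta Df Dg k = Df.red * Dg.red * (g * pd k f - f * pd k g) :=
    congrFun (mul_theta Df Dg) k
  have h2 : ¬ h ∣ f * g := fun h0 => (hh.dvd_or_dvd h0).elim hf hg
  have h3 : ¬ h ∣ Df.red * Dg.red := fun h0 => h2 (h0.trans (mul_dvd_mul Df.red_dvd Dg.red_dvd))
  constructor
  · intro h4
    refine hh.pow_dvd_of_dvd_mul_left j h3 ?_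
    rw [← h1]
    exact h4.mul_left _
  · intro h4
    refine hh.pow_dvd_of_dvd_mul_left j h2 ?_
    rw [h1]
    exact h4.mul_left _

/-- The Wronskian of f and g is that of h^(j+1) e and g, with leading part (j+1) g e h^j dh. One
power of h is lost, and only one, because j + 1 is invertible and h does not divide dh. -/
theorem pow_dvd_wronskian {c : ℂ} {e : convSeries n} (hh : Prime h) (hg : ¬ h ∣ g)
    {j : ℕ} (hfg : f - c • g = h ^ (j + 1) * e) (he : ¬ h ∣ e) :
    (∀ k, h ^ j ∣ g * pd k f - f * pd k g) ∧
      ∃ k, ¬ h ^ (j + 1) ∣ g * pd k f - f * pd k g := by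
  have key : ∀ k, g * pd k f - f * pd k g =
      h ^ j * (((j + 1 : ℕ) : convSeries n) * g * e * pd k h + h * (g * pd k e - e * pd k g)) := by
    intro k
    have hf : f = c • g + h ^ (j + 1) * e := by rw [← hfg]; ring
    have hpd : pd k f = c • pd k g + (h ^ (j + 1) * pd k e +
        e * (((j + 1 : ℕ) : convSeries n) * (h ^ j * pd k h))) := by
      rw [hf, map_add, Derivation.map_smul, Derivation.leibniz, Derivation.leibniz_pow]
      simp only [smul_eq_mul, nsmul_eq_mul, Nat.add_sub_cancel]
    rw [hpd]
    simp only [Algebra.smul_def] at hf ⊢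
    linear_combination (-pd k g) * hf
  refine ⟨fun k => by rw [key]; exact dvd_mul_right _ _, ?_⟩
  obtain ⟨k, hk⟩ := exists_not_dvd_pd hh.ne_zero hh.not_isUnit
  refine ⟨k, fun hdvd => ?_⟩
  rw [key, pow_succ] at hdvd
  have h1 := (dvd_add_left (dvd_mul_right h _)).1
    ((mul_dvd_mul_iff_left (pow_ne_zero j hh.ne_zero)).1 hdvd)
  rcases hh.dvd_or_dvd h1 with h2 | h2
  · rcases hh.dvd_or_dvd h2 with h3 | h3
    · rcases hh.dvd_or_dvd h3 with h4 | h4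
      · exact hh.not_isUnit (isUnit_of_dvd_unit h4 (isUnit_natCast (Nat.succ_ne_zero j)))
      · exact hg h4
    · exact he h3
  · exact hk h2

end theta

end ConvSeries

end

/-! ### The main theorem -/

theorem mainTheorem2 {n : ℕ} {f g : ConvSeries.convSeries n} (hfg : IsRelPrime f g)
    (Df : ConvSeries.Decomposition f) (Dg : ConvSeries.Decomposition g)
    (h : ConvSeries.convSeries n) (hh : Irreducible h) (ℓ : ℕ) (hℓ : 1 ≤ ℓ) :
    ConvSeries.IsSingComponent (ConvSeries.theta Df Dg) h ℓ ↔
      ∃ c : ℂ, c ≠ 0 ∧ emultiplicity h (f - c • g) = ((ℓ + 1 : ℕ) : ℕ∞) := by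
  open ConvSeries in
  have hp : Prime h := UniqueFactorizationMonoid.irreducible_iff_prime.1 hh
  constructor
  · rintro ⟨-, -, hdvd, hndvd⟩
    rw [dividesForm_iff] at hdvd hndvd
    push Not at hndvd
    obtain ⟨k, hk⟩ := hndvd
    have hθ : ∀ k, h ∣ theta Df Dg k := fun k =>
      (dvd_pow_self h (by omega)).trans (hdvd k)
    obtain ⟨hf, hg⟩ := not_dvd_of_dvd_theta hfg Df Dg hp hθ
    simp only [pow_dvd_theta_iff Df Dg hp hf hg] at hdvd hk
    obtain ⟨c, hc⟩ := exists_dvd_sub_smul hh hg fun k =>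
      (dvd_pow_self h (by omega)).trans (hdvd k)
    -- If f = c g, the Wronskian is zero and θ_φ is divisible by every power of h, against the
    -- finite multiplicity.
    have hne : f - c • g ≠ 0 := by
      intro h0
      refine hk ?_
      have h1 : g * pd k f - f * pd k g = 0 := by
        rw [sub_eq_zero.1 h0, Derivation.map_smul, mul_smul_comm, smul_mul_assoc, sub_self]
      rw [h1]
      exact dvd_zero _
    obtain ⟨e, he, hne⟩ :=
      (FiniteMultiplicity.of_not_isUnit hh.not_isUnit hne).exists_eq_pow_mul_and_not_dvd
    generalize multiplicity h (f - c • g) = m at he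
    -- The order m of f − c g along h is positive by the choice of c. The Wronskian has order
    -- exactly m − 1, which must therefore be ℓ.
    obtain ⟨j, rfl⟩ : ∃ j, m = j + 1 := by
      refine Nat.exists_eq_succ_of_ne_zero ?_
      rintro rfl
      rw [he, pow_zero, one_mul] at hc
      exact hne hc
    obtain ⟨h1, k', h2⟩ := pow_dvd_wronskian hp hg he hne
    have hjl : j = ℓ := by
      rcases lt_trichotomy j ℓ with hlt | heq | hgt
      · exact (h2 ((pow_dvd_pow h hlt).trans (hdvd k'))).elim
      · exact heq
      · exact (hk ((pow_dvd_pow h hgt).trans (h1 k))).elim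
    refine ⟨c, ?_, ?_⟩
    · rintro rfl
      rw [zero_smul, sub_zero] at hc
      exact hf hc
    · rw [emultiplicity_eq_coe, he, hjl]
      refine ⟨dvd_mul_right _ _, fun h3 => hne ?_⟩
      rw [pow_succ h (ℓ + 1)] at h3
      exact (mul_dvd_mul_iff_left (pow_ne_zero _ hp.ne_zero)).1 h3
  · rintro ⟨c, hc, hmul⟩
    obtain ⟨⟨e, he⟩, hnd⟩ := emultiplicity_eq_coe.1 hmul
    have hne : ¬ h ∣ e := by
      intro h1
      rw [he, pow_succ h (ℓ + 1)] at hnd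
      exact hnd (mul_dvd_mul_left _ h1)
    have hd : h ∣ f - c • g := (dvd_pow_self h (Nat.succ_ne_zero ℓ)).trans (Dvd.intro e he.symm)
    have hg : ¬ h ∣ g := by
      intro h1
      have h2 : h ∣ c • g := by rw [Algebra.smul_def]; exact h1.mul_left _
      have h3 := dvd_add hd h2
      rw [sub_add_cancel] at h3
      exact hp.not_isUnit (hfg h3 h1)
    -- Here c ≠ 0 is essential: for c = 0 the element h would be a multiple factor of f.
    have hf : ¬ h ∣ f := by
      intro h1
      have h2 : h ∣ c⁻¹ • (f - (f - c • g)) := by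
        rw [Algebra.smul_def]; exact (dvd_sub h1 hd).mul_left _
      rw [sub_sub_cancel, smul_smul, inv_mul_cancel₀ hc, one_smul] at h2
      exact hg h2
    obtain ⟨h1, k, h2⟩ := pow_dvd_wronskian hp hg he hne
    simp only [← pow_dvd_theta_iff Df Dg hp hf hg] at h1 h2
    -- The failure of divisibility by h^(ℓ+1) also shows that θ_φ is nonzero, as the component
    -- criterion requires.
    refine ⟨hh, isComponent_zeros_sing hh (fun h0 => h2 ?_) fun k =>
      (dvd_pow_self h (by omega)).trans (h1 k), dividesForm_iff.2 h1, fun h3 => h2 ?_⟩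
    · rw [h0]
      exact dvd_zero _
    · exact dividesForm_iff.1 h3 k
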